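/- Let $T_0>0$ and let $v:[0,T_0)\times\mathbb R^3\to\mathbb R^3$ and $\alpha:[0,T_0)\times\mathbb R^3\to\mathbb R$ be smooth. Consider the kinematic mean-field dynamo system $$\partial_t B=\nabla\times(v\times B)+\nabla\times(\alpha B),\qquad \nabla\cdot B=0 .\tag{1}$$ Call (1) well-posed in $L^2$ on $[0,T_0)$ if there are $T\in(0,T_0]$ and real constants $C,a$ such that for every smooth, compactly supported, divergence-free initial field $f$ there is a solution $B$ on $[0,T)$ (smooth on $[0,T)\times\mathbb R^3$, with $B(t,\cdot)\in L^2$ for all $t$, and $B(0)=f$) with $\|B(t)\|_{L^2}\le Ce^{at}\|f\|_{L^2}$ for $0\le t<T$, and this solution is unique among all such solutions. (Asking this of compactly supported data only makes the failure of well-posedness a stronger assertion.) Then the following hold. 1. (No strong hyperbolicity.) The principal part of the first equation in (1) is $\sum_j A^j\partial_jB$ with $A^j b=e_j\times(v\times b)+\alpha\,e_j\times b$. At every $(t,x)$ with $\alpha(t,x)\neq0$ it is not strongly hyperbolic, i.e. it is not true that for every $k\in\mathbb R^3$ the symbol $\sum_jk_jA^j$ is diagonalizable (over $\mathbb C$)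 with only real eigenvalues. 2. (Frozen coefficients.) Let $t_0\in[0,T_0)$ and $x_0\in\mathbb R^3$ with $\alpha_0:=\alpha(t_0,x_0)\ne0$, put $v_0:=v(t_0,x_0)$, and consider (1) with the constants $v_0,\alpha_0$ in place of $v,\alpha$. (a) For $k\in\mathbb R^3$ and $\omega\in\mathbb C$, the first equation has a solution $b\,e^{i(\omega t+k\cdot x)}$ with $0\ne b\in\mathbb C^3$ if and only if $$\omega\left[(k\cdot v_0+\omega)^2+|k|^2\alpha_0^2\right]=0$$ (for $k=(k,0,0)$ this is $\omega[(kv_1+\omega)^2+k^2\alpha_0^2]=0$). (b) For every $k\neq0$ there is $b\ne0$ such that $B=b\,e^{i(\omega t+k\cdot x)}$ with $\omega=-k\cdot v_0-i|k||\alpha_0|$ solves both equations of (1), and $|B(t,x)|=e^{|\alpha_0||k|t}|B(0,x)|$. For each fixed $t>0$ the factor $e^{|\alpha_0|kt}$ tends to $\infty$ as $k\to\infty$. (c) For all $0<t<T$ and all $C$ there is a real smooth solution $B$ of (1) on $[0,T)\times\mathbb R^3$ with $B(s)\in L^2$ for all $s\in[0,T)$ and $\|B(t)\|_{L^2}>C\|B(0)\|_{L^2}$.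 (d) The frozen system is not well-posed in $L^2$ on $[0,T)$, for any $T$. 3. (Variable coefficients.) If $\alpha(0,\cdot)$ is not identically zero, then (1) is not well-posed in $L^2$ on $[0,T_0)$. 4. (Coupling with a fluid.) Suppose again that $\alpha(0,\cdot)$ is not identically zero. Let $w:[0,T_0)\times\mathbb R^3\to\mathbb R^m$ denote the unknowns of a fluid theory: its velocity is $v=\ell(w)$ with $\ell:\mathbb R^m\to\mathbb R^3$ linear, its evolution equation is $\partial_tw=F(t,w(t),B(t))$ with an arbitrary operator $F$ acting on the fields at time $t$ (local or nonlocal, of any order in the space derivatives, linear or not), and there may be arbitrary constraints on $w$. Couple it to (1) with $v=\ell(w)$ and prescribed $\alpha$. Let $\bar w$ be a smooth background flow on $[0,T_0)$ such that $(\bar w,0)$ solves the coupled system. Then the coupled system is not well-posed in $L^2$ near $(\bar w,0)$. Here well-posedness near $(\bar w,0)$ means: there are $T\in(0,T_0]$, real $C,a$, an integer $N\ge0$ and $\eta>0$ such that for all smooth compactly supported $g:\mathbb R^3\to\mathbb R^m$ and $f:\mathbb R^3\to\mathbb R^3$, with $\nabla\cdot f=0$, with $\bar w(0)+g$ satisfying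 the constraints, and with all derivatives of $g$ and $f$ of order at most $N$ bounded by $\eta$ in $L^2$, there is a smooth solution $(w,B)$ on $[0,T)$ with initial value $(\bar w(0)+g,f)$ satisfying $\|w(t)-\bar w(t)\|_{L^2}+\|B(t)\|_{L^2}\le Ce^{at}(\|g\|_{L^2}+\|f\|_{L^2})$ for $0\le t<T$, and it is unique among the smooth solutions at finite $L^2$ distance from $(\bar w,0)$ for all $t\in[0,T)$. -/

import Mathlib

open Set MeasureTheory
open scoped ContDiff ENNReal

noncomputable section

namespace MeanFieldDynamo

/-- Physical space `ℝ³` with the Euclidean norm. -/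
abbrev Space : Type := EuclideanSpace ℝ (Fin 3)

/-- Values of real (`𝕜 = ℝ`) or complex (`𝕜 = ℂ`) vector fields. -/
abbrev Vec (𝕜 : Type) : Type := EuclideanSpace 𝕜 (Fin 3)

/-! ### Vector calculus -/

/-- The partial derivative `∂ⱼ F` of a vector field. -/
def pd {𝕜 : Type} [RCLike 𝕜] (j : Fin 3) (F : Space → Vec 𝕜) (x : Space) : Vec 𝕜 :=
  fderiv ℝ F x (EuclideanSpace.single j 1)

/-- `∇ × F`. -/
def curl {𝕜 : Type} [RCLike 𝕜] (F : Space → Vec 𝕜) (x : Space) : Vec 𝕜 :=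
  !₂[pd 1 F x 2 - pd 2 F x 1, pd 2 F x 0 - pd 0 F x 2, pd 0 F x 1 - pd 1 F x 0]

/-- `∇ · F`. -/
def div {𝕜 : Type} [RCLike 𝕜] (F : Space → Vec 𝕜) (x : Space) : 𝕜 :=
  ∑ j, pd j F x j

/-- The cross product `a × b` of a real vector with a real or complex vector. -/
def cross {𝕜 : Type} [RCLike 𝕜] (a : Space) (b : Vec 𝕜) : Vec 𝕜 :=
  !₂[a 1 • b 2 - a 2 • b 1, a 2 • b 0 - a 0 • b 2, a 0 • b 1 - a 1 • b 0]

/-! ### The kinematic mean-field dynamo equation -/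

/-- The spatial operator `B ↦ ∇ × (v × B) + ∇ × (α B)`. -/
def dynamoOp {𝕜 : Type} [RCLike 𝕜] (v : Space → Space) (α : Space → ℝ)
    (B : Space → Vec 𝕜) (x : Space) : Vec 𝕜 :=
  curl (fun y => cross (v y) (B y)) x + curl (fun y => α y • B y) x

/-- The equation `∂ₜ B = ∇ × (v × B) + ∇ × (α B)` at the times in `I`. -/
def InductionEq {𝕜 : Type} [RCLike 𝕜] (I : Set ℝ) (v : ℝ → Space → Space)
    (α : ℝ → Space → ℝ) (B : ℝ → Space → Vec 𝕜) : Prop :=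
  ∀ t ∈ I, ∀ x, HasDerivAt (fun s => B s x) (dynamoOp (v t) (α t) (B t) x) t

/-- Smoothness on `[0, T) × ℝ³` of a time-dependent field (up to and including `t = 0`). -/
def SmoothOn {E : Type} [NormedAddCommGroup E] [NormedSpace ℝ E] (T : ℝ)
    (u : ℝ → Space → E) : Prop :=
  ContDiffOn ℝ ∞ (fun p : ℝ × Space => u p.1 p.2) (Ico 0 T ×ˢ univ)

/-- The `L²(ℝ³)` norm. -/
def normL2 {E : Type} [NormedAddCommGroup E] (f : Space → E) : ℝ≥0∞ :=
  eLpNorm f 2 volume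

/-- Smooth finite-energy solutions on `[0, T)` of the initial-value problem for the system
`∂ₜ B = ∇ × (v × B) + ∇ × (α B)`, `∇ · B = 0`, with initial value `f`. -/
structure IsSolution (T : ℝ) (v : ℝ → Space → Space) (α : ℝ → Space → ℝ)
    (f : Space → Space) (B : ℝ → Space → Space) : Prop where
  smooth : SmoothOn T B
  finite_energy : ∀ t ∈ Ico 0 T, MemLp (B t) 2 volume
  induction_eq : InductionEq (Ioo 0 T) v α B
  div_free : ∀ t ∈ Ico 0 T, ∀ x, div (B t) x = 0
  initial : B 0 = f

/-- Smooth, compactly supported, divergence-free initial magnetic fields. -/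
structure IsMagneticDatum (f : Space → Space) : Prop where
  smooth : ContDiff ℝ ∞ f
  compact : HasCompactSupport f
  div_free : ∀ x, div f x = 0

/-- Well-posedness in the `L²` norm of the initial-value problem with coefficients given on
`[0, T₀)`: on some common time interval `[0, T)` every datum has a solution obeying
`‖B(t)‖ ≤ C e^{a t} ‖f‖`, with `C` and `a` independent of the datum, and solutions are unique.
Only compactly supported data are asked for, so that the failure of this property implies the
failure of its variants with more initial data. -/
def WellPosedL2 (T₀ : ℝ) (v : ℝ → Space → Space) (α : ℝ → Space → ℝ) : Prop :=
  ∃ T : ℝ, 0 < T ∧ T ≤ T₀ ∧ ∃ C a : ℝ, ∀ f : Space → Space, IsMagneticDatum f →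
    (∃ B, IsSolution T v α f B ∧
      ∀ t ∈ Ico 0 T, normL2 (B t) ≤ ENNReal.ofReal (C * Real.exp (a * t)) * normL2 f) ∧
    (∀ B B', IsSolution T v α f B → IsSolution T v α f B' → ∀ t ∈ Ico 0 T, B t = B' t)

/-! ### Principal part and strong hyperbolicity -/

/-- The matrix fields `A x 0, A x 1, A x 2` are the principal part of the linear first-order
operator `L`, that is `L B = ∑ⱼ Aʲ ∂ⱼ B + Q B` with a matrix field `Q`. -/
def HasPrincipalPart (L : (Space → Space) → Space → Space)
    (A : Space → Fin 3 → Matrix (Fin 3) (Fin 3) ℝ) : Prop :=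
  ∃ Q : Space → Matrix (Fin 3) (Fin 3) ℝ, ∀ B : Space → Space, ContDiff ℝ ∞ B → ∀ x i,
    L B x i = (∑ j, (A x j).mulVec (pd j B x).ofLp i) + (Q x).mulVec (B x).ofLp i

/-- The principal symbol `∑ⱼ kⱼ Aʲ`. -/
def symbol {N : ℕ} (A : Fin 3 → Matrix (Fin N) (Fin N) ℝ) (k : Space) :
    Matrix (Fin N) (Fin N) ℝ :=
  ∑ j, k j • A j

/-- The constant-coefficient system `∂ₜ u = ∑ⱼ Aʲ ∂ⱼ u` is strongly hyperbolic: for every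
covector `k` the principal symbol is diagonalizable with only real eigenvalues. -/
def StronglyHyperbolic {N : ℕ} (A : Fin 3 → Matrix (Fin N) (Fin N) ℝ) : Prop :=
  ∀ k : Space, ∃ (P : Matrix (Fin N) (Fin N) ℂ) (d : Fin N → ℝ), IsUnit P.det ∧
    (symbol A k).map (fun r : ℝ => (r : ℂ)) =
      P * Matrix.diagonal (fun i => (d i : ℂ)) * P⁻¹

/-- The matrices of `B ↦ eⱼ × (v × B) + α eⱼ × B`. -/
def dynamoMatrix (v : Space) (α : ℝ) (j : Fin 3) : Matrix (Fin 3) (Fin 3) ℝ :=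
  Matrix.of fun i l =>
    cross (EuclideanSpace.single j (1 : ℝ)) (cross v (EuclideanSpace.single l (1 : ℝ)) +
      α • EuclideanSpace.single l (1 : ℝ)) i

/-! ### Plane waves -/

/-- The mode `b e^{i (ν t + k · x)}`. -/
def planeWave (ν : ℂ) (k : Space) (b : Vec ℂ) (t : ℝ) (x : Space) : Vec ℂ :=
  Complex.exp (Complex.I * (ν * t + ((inner ℝ k x : ℝ) : ℂ))) • b

/-! ### Coupling with a fluid -/

/-- A fluid theory with `m` scalar unknowns, collected in a field `w : ℝ³ → ℝᵐ`: evolution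
equations `∂ₜ w = F(t, w, B)`, where `F` is any operator (local or not, of any order in the space
derivatives, linear or not) acting on the fields at time `t`, and possibly constraints on `w`
(such as incompressibility). The fluid velocity is a linear function of the unknowns, for instance
three of them. -/
structure FluidTheory (m : ℕ) where
  vel : EuclideanSpace ℝ (Fin m) →ₗ[ℝ] Space
  rhs : ℝ → (Space → EuclideanSpace ℝ (Fin m)) → (Space → Space) →
    Space → EuclideanSpace ℝ (Fin m)
  constraint : (Space → EuclideanSpace ℝ (Fin m)) → Prop

/-- Smooth solutions `(w, B)` on `[0, T)` of the coupled system: the fluid equations with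
magnetic field `B` together with the dynamo equation with the velocity given by `w`. -/
structure IsCoupledSolution {m : ℕ} (T : ℝ) (α : ℝ → Space → ℝ) (𝓕 : FluidTheory m)
    (w : ℝ → Space → EuclideanSpace ℝ (Fin m)) (B : ℝ → Space → Space) : Prop where
  smooth_fluid : SmoothOn T w
  smooth_magnetic : SmoothOn T B
  fluid_eq : ∀ t ∈ Ioo 0 T, ∀ x, HasDerivAt (fun s => w s x) (𝓕.rhs t (w t) (B t) x) t
  constraint : ∀ t ∈ Ico 0 T, 𝓕.constraint (w t)
  induction_eq : InductionEq (Ioo 0 T) (fun t x => 𝓕.vel (w t x)) α B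
  div_free : ∀ t ∈ Ico 0 T, ∀ x, div (B t) x = 0

/-- The `L²` distance of two states of the coupled system. -/
def coupledDist {m : ℕ} (w w' : Space → EuclideanSpace ℝ (Fin m)) (B B' : Space → Space) :
    ℝ≥0∞ :=
  normL2 (fun x => w x - w' x) + normL2 (fun x => B x - B' x)

/-- All derivatives of order at most `N` are at most `η` in `L²`. -/
def SobolevSmall {E : Type} [NormedAddCommGroup E] [NormedSpace ℝ E] (N : ℕ) (η : ℝ)
    (f : Space → E) : Prop :=
  ∀ j ≤ N, normL2 (iteratedFDeriv ℝ j f) ≤ ENNReal.ofReal η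

/-- Well-posedness in the `L²` norm of the (in general nonlinear) coupled system near a reference
solution `(w₀, B₀)` on `[0, T₀)`: for all smooth, compactly supported perturbations `(g, f)` of its
initial value that respect the constraints and are small in some Sobolev norm, there is a
solution on a common time interval `[0, T)` whose distance to the reference solution satisfies
`dist(t) ≤ C e^{a t} dist(0)` with `C` and `a` independent of the perturbation, and solutions at
finite `L²` distance from the reference solution are determined by their initial values. -/
def CoupledWellPosedL2 {m : ℕ} (T₀ : ℝ) (α : ℝ → Space → ℝ) (𝓕 : FluidTheory m)
    (w₀ : ℝ → Space → EuclideanSpace ℝ (Fin m)) (B₀ : ℝ → Space → Space) : Prop :=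
  ∃ T : ℝ, 0 < T ∧ T ≤ T₀ ∧ ∃ C a : ℝ, ∃ N : ℕ, ∃ η : ℝ, 0 < η ∧
    ∀ (g : Space → EuclideanSpace ℝ (Fin m)) (f : Space → Space),
      ContDiff ℝ ∞ g → HasCompactSupport g → 𝓕.constraint (fun x => w₀ 0 x + g x) →
      IsMagneticDatum f → SobolevSmall N η g → SobolevSmall N η f →
      (∃ w B, IsCoupledSolution T α 𝓕 w B ∧
        w 0 = (fun x => w₀ 0 x + g x) ∧ B 0 = (fun x => B₀ 0 x + f x) ∧
        ∀ t ∈ Ico 0 T, coupledDist (w t) (w₀ t) (B t) (B₀ t) ≤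
          ENNReal.ofReal (C * Real.exp (a * t)) * (normL2 g + normL2 f)) ∧
      (∀ w B w' B', IsCoupledSolution T α 𝓕 w B → IsCoupledSolution T α 𝓕 w' B' →
        w 0 = (fun x => w₀ 0 x + g x) → B 0 = (fun x => B₀ 0 x + f x) →
        w' 0 = w 0 → B' 0 = B 0 →
        (∀ t ∈ Ico 0 T, coupledDist (w t) (w₀ t) (B t) (B₀ t) < ⊤) →
        (∀ t ∈ Ico 0 T, coupledDist (w' t) (w₀ t) (B' t) (B₀ t) < ⊤) →
        ∀ t ∈ Ico 0 T, w t = w' t ∧ B t = B' t)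

end MeanFieldDynamo

end

/-!
With constant coefficients `v₀`, `α₀` and for divergence-free `B` the dynamo equation reads
`∂ₜ B + (v₀ · ∇) B = α₀ ∇ × B`. The curl has real eigenvalues `±|k|` on the divergence-free modes of
wave vector `k`, hence `e^{|α₀| |k| t}` is a growth factor and no `L²` bound is uniform in `k`.
Algebraically, the principal symbol has the characteristic polynomial
`ν ((k · v₀ + ν)² + |k|² α₀²)` (`det_sub_symbol`), which gives the failure of strong hyperbolicity,
the dispersion relation and the growing plane waves.

Finite-energy solutions with constant coefficients and arbitrarily large amplification are explicit.
Since `(∇ ×)² = -Δ` on divergence-free fields, for `σ = ±1` the field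
`(-∂₀ + σ ∇ ×) ∇ × (u e₃)` satisfies `∂₀ b = -σ ∇ × b` whenever `u` is harmonic on `ℝ × ℝ³`
(`beltramiComp_equations`). Here `u` is the `n`-th derivative of the Newtonian kernel of `ℝ⁴` along
the first factor. Then `b` is homogeneous of degree `-4 - n`, and its `L²` norm over the slice at
distance `c` from the origin is a nonzero multiple of `c ^ (-5/2 - n)`. Letting `c = |α₀| (T - t)`
shrink from `t = 0` to a fixed later time amplifies the norm by a power of a number greater than one,
with an exponent that grows with `n` (`exists_amplified_solution`).

For variable coefficients, where solutions need not exist, an assumed family of bounded solutions is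
tested with localized waves. Take a unit vector `k` orthogonal to `v₀` and a real Beltrami wave `ψ` of
wave vector `μ k`, so that `∇ × ψ = ± μ ψ`, `|ψ| = 1` and `(v₀ · ∇) ψ = 0`
(`exists_beltrami_wave`), and a cutoff `χ` near a point where `α ≠ 0`. All derivatives in the operator
can be moved to `χ ψ`, so the pairing `I(t) = ∫ B(t) · χ ψ` satisfies `I' = |α₀| μ I + E`, where `E` is
bounded by the norm of `B` times a constant plus a small multiple of `μ`
(`abs_integral_dynamoOp_sub_le`). Integrating, `I(0)` is at most `e^{-|α₀| μ t₁} I(t₁)` plus the bound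
of `E` divided by `|α₀| μ` (`pairing_zero_le`), which is small compared with the norm of the data when
`μ` is large. But the divergence-free field `± μ⁻¹ ∇ × (χ ψ)` as initial value is almost parallel to
`χ ψ`, so that `I(0)` is not small. When the velocity itself belongs to the unknowns of a
coupled system, its deviation from the background enters `E` quadratically in the size of the data and
is negligible for small multiples of the same initial value; this is why `exists_unstable_datum` is
stated for all small multiples, and it covers the linear and the coupled problem alike.
-/

noncomputable section

namespace MeanFieldDynamo

/-! ### Vector calculus -/

section Calculus

variable {𝕜 : Type} [RCLike 𝕜]

lemma pd_apply {F : Space → Vec 𝕜} {x : Space} (hF : DifferentiableAt ℝ F x) (j i : Fin 3) :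
    pd j F x i = fderiv ℝ (fun y => F y i) x (EuclideanSpace.single j 1) := by
  have h : HasFDerivAt (fun y => F y i)
      (((EuclideanSpace.proj i : Vec 𝕜 →L[𝕜] 𝕜).restrictScalars ℝ).comp (fderiv ℝ F x)) x :=
    ((EuclideanSpace.proj i : Vec 𝕜 →L[𝕜] 𝕜).restrictScalars ℝ).hasFDerivAt.comp x hF.hasFDerivAt
  rw [h.fderiv]
  rfl

lemma pd_add {F G : Space → Vec 𝕜} {x : Space} (hF : DifferentiableAt ℝ F x)
    (hG : DifferentiableAt ℝ G x) (j : Fin 3) :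
    pd j (fun y => F y + G y) x = pd j F x + pd j G x := by
  simp only [pd]
  rw [fderiv_fun_add hF hG]
  rfl

lemma pd_const (c : Vec 𝕜) (j : Fin 3) (x : Space) : pd j (fun _ => c) x = 0 := by
  simp [pd]

lemma pd_smul {a : Space → ℝ} {F : Space → Vec 𝕜} {x : Space} (ha : DifferentiableAt ℝ a x)
    (hF : DifferentiableAt ℝ F x) (j : Fin 3) :
    pd j (fun y => a y • F y) x =
      fderiv ℝ a x (EuclideanSpace.single j 1) • F x + a x • pd j F x := by
  simp only [pd]
  rw [fderiv_fun_smul ha hF]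
  simp [add_comm]

/-- The cross product as a continuous bilinear map. -/
def crossL : Space →L[ℝ] Vec 𝕜 →L[ℝ] Vec 𝕜 :=
  LinearMap.toContinuousLinearMap
    { toFun := fun a => LinearMap.toContinuousLinearMap
        { toFun := fun b => cross a b
          map_add' := by
            intro b c; ext i; fin_cases i <;> simp [cross] <;> ring
          map_smul' := by
            intro r b; ext i; fin_cases i <;> simp [cross, RCLike.real_smul_eq_coe_mul] <;> ring }
      map_add' := by
        intro a b; ext c i; fin_cases i <;> simp [cross, add_smul] <;> ring
      map_smul' := by
        intro r b; ext c i; fin_cases i <;> simp [cross, RCLike.real_smul_eq_coe_mul] <;> ring }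

lemma crossL_apply (a : Space) (b : Vec 𝕜) : crossL a b = cross a b := rfl

lemma contDiff_cross : ContDiff ℝ ∞ (fun p : Space × Vec 𝕜 => cross p.1 p.2) :=
  (crossL (𝕜 := 𝕜)).isBoundedBilinearMap.contDiff

lemma pd_cross {v : Space → Space} {F : Space → Vec 𝕜} {x : Space} (hv : DifferentiableAt ℝ v x)
    (hF : DifferentiableAt ℝ F x) (j : Fin 3) :
    pd j (fun y => cross (v y) (F y)) x = cross (pd j v x) (F x) + cross (v x) (pd j F x) := by
  have h := (crossL (𝕜 := 𝕜)).hasFDerivAt_of_bilinear hv.hasFDerivAt hF.hasFDerivAt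
  simp only [pd]
  change fderiv ℝ (fun y => crossL (v y) (F y)) x _ = _
  rw [h.fderiv]
  simp [crossL_apply, add_comm]

/-- With constant coefficients the dynamo operator is `∑ⱼ Aʲ ∂ⱼ`. -/
lemma dynamoOp_const {B : Space → Vec 𝕜} {x : Space} (hB : DifferentiableAt ℝ B x) (v : Space)
    (α : ℝ) (i : Fin 3) :
    dynamoOp (fun _ => v) (fun _ => α) B x i =
      ∑ j, ∑ l, (dynamoMatrix v α j i l : ℝ) • pd j B x l := by
  have h1 (j : Fin 3) : pd j (fun y => cross v (B y)) x = cross v (pd j B x) := by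
    rw [pd_cross (differentiableAt_const v) hB, pd_const]
    ext i; fin_cases i <;> simp [cross]
  have h2 (j : Fin 3) : pd j (fun y => α • B y) x = α • pd j B x := by
    rw [pd_smul (differentiableAt_const α) hB]
    simp
  simp only [dynamoOp, curl, h1, h2]
  fin_cases i <;>
  simp [cross, dynamoMatrix, Fin.sum_univ_three, RCLike.real_smul_eq_coe_mul] <;> ring

end Calculus

lemma SmoothOn.slice {E : Type} [NormedAddCommGroup E] [NormedSpace ℝ E] {T t : ℝ}
    {u : ℝ → Space → E} (hu : SmoothOn T u) (ht : t ∈ Ico 0 T) : ContDiff ℝ ∞ (u t) := by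
  have h : ContDiffOn ℝ ∞ (fun x : Space => ((t, x) : ℝ × Space)) univ := by fun_prop
  have hu' : ContDiffOn ℝ ∞ (fun p : ℝ × Space => u p.1 p.2) (Ico 0 T ×ˢ univ) := hu
  exact contDiffOn_univ.1 (hu'.comp h (fun x _ => ⟨ht, mem_univ x⟩))

/-! ### Principal part and dispersion relation -/

lemma hasPrincipalPart_dynamoOp {v : Space → Space} {α : Space → ℝ} (hv : Differentiable ℝ v)
    (hα : Differentiable ℝ α) :
    HasPrincipalPart (dynamoOp v α) (fun x => dynamoMatrix (v x) (α x)) := by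
  refine ⟨fun x => Matrix.of fun i l => dynamoOp v α (fun _ => EuclideanSpace.single l (1 : ℝ)) x i,
    fun B hB x i => ?_⟩
  have hB' : Differentiable ℝ B := hB.differentiable (by simp)
  have h1 (j : Fin 3) := pd_cross (hv x) (hB' x) j
  have h2 (j : Fin 3) := pd_smul (hα x) (hB' x) j
  have h3 (j l : Fin 3) := pd_cross (hv x)
    (differentiableAt_const (x := x) (EuclideanSpace.single l (1 : ℝ) : Vec ℝ)) j
  have h4 (j l : Fin 3) := pd_smul (hα x)
    (differentiableAt_const (x := x) (EuclideanSpace.single l (1 : ℝ) : Vec ℝ)) j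
  simp only [dynamoOp, curl, h1, h2, h3, h4, pd_const]
  fin_cases i <;>
  simp [cross, dynamoMatrix, Fin.sum_univ_three, Matrix.mulVec, dotProduct] <;> ring

/-- The characteristic polynomial of the principal symbol at the covector `k`. -/
lemma det_sub_symbol (v : Space) (α : ℝ) (k : Space) (ν : ℂ) :
    (Matrix.scalar (Fin 3) ν -
      (symbol (dynamoMatrix v α) k).map (fun r : ℝ => (r : ℂ))).det =
    ν * ((((inner ℝ k v : ℝ) : ℂ) + ν) ^ 2 + ((‖k‖ : ℝ) : ℂ) ^ 2 * ((α : ℝ) : ℂ) ^ 2) := by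
  have h : ((‖k‖ : ℝ) : ℂ) ^ 2 = (k 0 : ℂ) ^ 2 + (k 1 : ℂ) ^ 2 + (k 2 : ℂ) ^ 2 := by
    rw [← Complex.ofReal_pow, EuclideanSpace.norm_sq_eq]
    simp [Fin.sum_univ_three]
  have h' : ((inner ℝ k v : ℝ) : ℂ) = k 0 * v 0 + k 1 * v 1 + k 2 * v 2 := by
    simp [PiLp.inner_apply, Fin.sum_univ_three, mul_comm]
  rw [h, h', Matrix.det_fin_three]
  simp [symbol, dynamoMatrix, cross, Fin.sum_univ_three]
  ring

lemma not_stronglyHyperbolic (v : Space) {α : ℝ} (hα : α ≠ 0) :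
    ¬ StronglyHyperbolic (dynamoMatrix v α) := by
  intro h
  set k : Space := EuclideanSpace.single 0 1
  obtain ⟨P, d, hP, hd⟩ := h k
  -- the covector `k` has the non-real characteristic value `-k · v + i α`
  have hdet := det_sub_symbol v α k (-(inner ℝ k v : ℝ) + Complex.I * (α : ℝ))
  have hk : ‖k‖ = 1 := by simp [k]
  have h0 : (-(inner ℝ k v : ℝ) + Complex.I * (α : ℝ) : ℂ) *
      ((((inner ℝ k v : ℝ) : ℂ) + (-(inner ℝ k v : ℝ) + Complex.I * (α : ℝ))) ^ 2 +
        ((‖k‖ : ℝ) : ℂ) ^ 2 * ((α : ℝ) : ℂ) ^ 2) = 0 := by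
    rw [hk]
    have : Complex.I ^ 2 = -1 := Complex.I_sq
    push_cast
    linear_combination (-(inner ℝ k v : ℝ) + Complex.I * (α : ℝ) : ℂ) * (α : ℂ) ^ 2 * this
  rw [h0, hd] at hdet
  set ν : ℂ := -(inner ℝ k v : ℝ) + Complex.I * (α : ℝ)
  have hs : Matrix.scalar (Fin 3) ν = P * Matrix.scalar (Fin 3) ν * P⁻¹ := by
    rw [← (Matrix.scalar_commute ν (fun r => Commute.all _ r) P).eq, mul_assoc,
      Matrix.mul_nonsing_inv _ hP, mul_one]
  rw [hs, ← sub_mul, ← mul_sub, Matrix.det_mul, Matrix.det_mul] at hdet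
  have hP' : (P⁻¹).det ≠ 0 := by
    have := (Matrix.isUnit_nonsing_inv_det_iff (A := P)).2 hP
    exact this.ne_zero
  have hz := (mul_eq_zero.1 ((mul_eq_zero.1 hdet).resolve_right hP')).resolve_left hP.ne_zero
  rw [Matrix.scalar_apply, Matrix.diagonal_sub, Matrix.det_diagonal, Finset.prod_eq_zero_iff] at hz
  obtain ⟨i, -, hi⟩ := hz
  have := congrArg Complex.im hi
  simp [ν] at this
  exact hα this

/-! ### Plane waves -/

lemma hasFDerivAt_planeWave (ν : ℂ) (k : Space) (b : Vec ℂ) (t : ℝ) (x : Space) :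
    HasFDerivAt (planeWave ν k b t)
      ((Complex.ofRealCLM.comp (innerSL ℝ k)).smulRight (Complex.I • planeWave ν k b t x)) x := by
  have h1 : HasFDerivAt (fun y : Space => ((inner ℝ k y : ℝ) : ℂ))
      (Complex.ofRealCLM.comp (innerSL ℝ k)) x :=
    (Complex.ofRealCLM.comp (innerSL ℝ k)).hasFDerivAt
  have h2 := (((h1.const_add (ν * t)).const_mul Complex.I).cexp).smul_const b
  refine h2.congr_fderiv ?_
  ext y i
  simp [planeWave]
  ring

lemma differentiableAt_planeWave (ν : ℂ) (k : Space) (b : Vec ℂ) (t : ℝ) (x : Space) :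
    DifferentiableAt ℝ (planeWave ν k b t) x :=
  (hasFDerivAt_planeWave ν k b t x).differentiableAt

lemma pd_planeWave (ν : ℂ) (k : Space) (b : Vec ℂ) (t : ℝ) (x : Space) (j : Fin 3) :
    pd j (planeWave ν k b t) x = (Complex.I * k j) • planeWave ν k b t x := by
  rw [pd, (hasFDerivAt_planeWave ν k b t x).fderiv]
  ext i
  simp [EuclideanSpace.inner_single_right]
  ring

lemma hasDerivAt_planeWave (ν : ℂ) (k : Space) (b : Vec ℂ) (t : ℝ) (x : Space) :
    HasDerivAt (fun s => planeWave ν k b s x) ((Complex.I * ν) • planeWave ν k b t x) t := by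
  have h1 : HasDerivAt (fun s : ℝ => (s : ℂ)) 1 t := Complex.ofRealCLM.hasDerivAt
  have h2 := ((((h1.const_mul ν).add_const ((inner ℝ k x : ℝ) : ℂ)).const_mul
    Complex.I).cexp).smul_const b
  refine h2.congr_deriv ?_
  ext i
  simp [planeWave]
  ring

lemma dynamoOp_planeWave (v : Space) (α : ℝ) (ν : ℂ) (k : Space) (b : Vec ℂ) (t : ℝ) (x : Space)
    (i : Fin 3) :
    dynamoOp (fun _ => v) (fun _ => α) (planeWave ν k b t) x i =
      Complex.I * Complex.exp (Complex.I * (ν * t + ((inner ℝ k x : ℝ) : ℂ))) *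
        ((symbol (dynamoMatrix v α) k).map (fun r : ℝ => (r : ℂ))).mulVec b.ofLp i := by
  rw [dynamoOp_const (differentiableAt_planeWave ν k b t x)]
  simp only [pd_planeWave, symbol, planeWave, Matrix.mulVec, dotProduct, Finset.mul_sum,
    Matrix.map_apply, Matrix.sum_apply, Matrix.smul_apply, Complex.ofReal_sum, Finset.sum_mul,
    PiLp.smul_apply, smul_eq_mul, Complex.ofReal_mul, Complex.real_smul]
  rw [Finset.sum_comm]
  refine Finset.sum_congr rfl fun l _ => Finset.sum_congr rfl fun j _ => ?_
  ring

lemma inductionEq_planeWave_iff (v : Space) (α : ℝ) (ν : ℂ) (k : Space) (b : Vec ℂ) :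
    InductionEq univ (fun _ _ => v) (fun _ _ => α) (planeWave ν k b) ↔
      (Matrix.scalar (Fin 3) ν -
        (symbol (dynamoMatrix v α) k).map (fun r : ℝ => (r : ℂ))).mulVec b.ofLp = 0 := by
  have key (t : ℝ) (x : Space) :
      HasDerivAt (fun s => planeWave ν k b s x)
        (dynamoOp (fun _ => v) (fun _ => α) (planeWave ν k b t) x) t ↔
      (Matrix.scalar (Fin 3) ν -
        (symbol (dynamoMatrix v α) k).map (fun r : ℝ => (r : ℂ))).mulVec b.ofLp = 0 := by
    have h := hasDerivAt_planeWave ν k b t x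
    have h' : HasDerivAt (fun s => planeWave ν k b s x)
        (dynamoOp (fun _ => v) (fun _ => α) (planeWave ν k b t) x) t ↔
        (Complex.I * ν) • planeWave ν k b t x =
          dynamoOp (fun _ => v) (fun _ => α) (planeWave ν k b t) x :=
      ⟨fun h2 => h.unique h2, fun h2 => h2 ▸ h⟩
    rw [h', Matrix.sub_mulVec, sub_eq_zero, PiLp.ext_iff, funext_iff]
    refine forall_congr' fun i => ?_
    rw [dynamoOp_planeWave]
    have he : Complex.I * Complex.exp (Complex.I * (ν * t + ((inner ℝ k x : ℝ) : ℂ))) ≠ 0 :=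
      mul_ne_zero Complex.I_ne_zero (Complex.exp_ne_zero _)
    have : (Matrix.scalar (Fin 3) ν).mulVec b.ofLp i = ν * b i := by
      simp [Matrix.scalar_apply, Matrix.mulVec_diagonal]
    rw [this]
    simp only [planeWave, PiLp.smul_apply, smul_eq_mul]
    constructor
    · intro h3
      apply mul_left_cancel₀ he
      linear_combination h3
    · intro h3
      rw [← h3]
      ring
  constructor
  · intro h
    exact (key 0 0).1 (h 0 (mem_univ _) 0)
  · intro h t _ x
    exact (key t x).2 h

lemma exists_planeWave_iff (v : Space) (α : ℝ) (k : Space) (ν : ℂ) :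
    (∃ b : Vec ℂ, b ≠ 0 ∧
      InductionEq univ (fun _ _ => v) (fun _ _ => α) (planeWave ν k b)) ↔
    ν * ((((inner ℝ k v : ℝ) : ℂ) + ν) ^ 2 + ((‖k‖ : ℝ) : ℂ) ^ 2 * ((α : ℝ) : ℂ) ^ 2) = 0 := by
  rw [← det_sub_symbol, ← Matrix.exists_mulVec_eq_zero_iff]
  constructor
  · rintro ⟨b, hb, h⟩
    refine ⟨b.ofLp, ?_, (inductionEq_planeWave_iff v α ν k b).1 h⟩
    intro h0; exact hb (by ext i; simp [h0])
  · rintro ⟨b, hb, h⟩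
    refine ⟨WithLp.toLp 2 b, ?_, (inductionEq_planeWave_iff v α ν k _).2 h⟩
    intro h0; exact hb (by simpa using h0)

/-- A plane wave solution of nonzero frequency is divergence-free, because the symbol at `k` takes
its values in the orthogonal complement of `k`. -/
lemma sum_mul_eq_zero_of_mulVec_eq_zero {v : Space} {α : ℝ} {ν : ℂ} {k : Space} {b : Vec ℂ}
    (hν : ν ≠ 0)
    (h : (Matrix.scalar (Fin 3) ν -
      (symbol (dynamoMatrix v α) k).map (fun r : ℝ => (r : ℂ))).mulVec b.ofLp = 0) :
    ∑ j, (k j : ℂ) * b j = 0 := by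
  have h0 := congrFun h 0
  have h1 := congrFun h 1
  have h2 := congrFun h 2
  simp [symbol, dynamoMatrix, cross, Fin.sum_univ_three, Matrix.mulVec, dotProduct] at h0 h1 h2
  rw [Fin.sum_univ_three]
  apply mul_left_cancel₀ hν
  linear_combination (k 0 : ℂ) * h0 + (k 1 : ℂ) * h1 + (k 2 : ℂ) * h2

lemma exists_growing_planeWave (v : Space) {α : ℝ} (hα : α ≠ 0) {k : Space} (hk : k ≠ 0) :
    ∃ b : Vec ℂ, b ≠ 0 ∧ ∃ B : ℝ → Space → Vec ℂ,
      B = planeWave (-((inner ℝ k v : ℝ) : ℂ) - Complex.I * ((‖k‖ * |α| : ℝ) : ℂ)) k b ∧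
      InductionEq univ (fun _ _ => v) (fun _ _ => α) B ∧
      (∀ t x, div (B t) x = 0) ∧
      (∀ t x, ‖B t x‖ = Real.exp (|α| * ‖k‖ * t) * ‖B 0 x‖) := by
  set ν : ℂ := -((inner ℝ k v : ℝ) : ℂ) - Complex.I * ((‖k‖ * |α| : ℝ) : ℂ) with hν
  have hν0 : ν ≠ 0 := by
    intro h
    have := congrArg Complex.im h
    simp [hν] at this
    tauto
  have hα2 : ((|α| : ℝ) : ℂ) ^ 2 = (α : ℂ) ^ 2 := by
    rw [← Complex.ofReal_pow, sq_abs, Complex.ofReal_pow]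
  obtain ⟨b, hb, h⟩ := (exists_planeWave_iff v α k ν).2 (by
    have hI : Complex.I ^ 2 = -1 := Complex.I_sq
    have h0 : (((inner ℝ k v : ℝ) : ℂ) + ν) ^ 2 +
        ((‖k‖ : ℝ) : ℂ) ^ 2 * ((α : ℝ) : ℂ) ^ 2 = 0 := by
      rw [hν]
      push_cast
      linear_combination (‖k‖ : ℂ) ^ 2 * (|α| : ℝ) ^ 2 * hI - (‖k‖ : ℂ) ^ 2 * hα2
    rw [h0, mul_zero])
  refine ⟨b, hb, _, rfl, h, fun t x => ?_, fun t x => ?_⟩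
  · have h0 := sum_mul_eq_zero_of_mulVec_eq_zero hν0 ((inductionEq_planeWave_iff v α ν k b).1 h)
    simp only [div, pd_planeWave]
    simp only [planeWave, PiLp.smul_apply, smul_eq_mul]
    have : ∀ j, Complex.I * (k j : ℂ) *
        (Complex.exp (Complex.I * (ν * t + ((inner ℝ k x : ℝ) : ℂ))) * b j) =
        Complex.I * Complex.exp (Complex.I * (ν * t + ((inner ℝ k x : ℝ) : ℂ))) *
          ((k j : ℂ) * b j) := fun j => by ring
    simp only [this]
    rw [← Finset.mul_sum, h0, mul_zero]
  · simp only [planeWave, norm_smul, Complex.norm_exp]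
    rw [← mul_assoc, ← Real.exp_add]
    congr 2
    simp [hν]
    left
    ring

/-! ### Homogeneous functions on `ℝ × ℝ³` -/

/-- The derivative of `u` in the direction `e`. -/
def dirDeriv (e : ℝ × Space) (u : ℝ × Space → ℝ) (p : ℝ × Space) : ℝ := fderiv ℝ u p e

/-- Functions on `ℝ × ℝ³` that are smooth away from the origin and positively homogeneous of
degree `d`; their values at the origin are irrelevant. -/
structure HomogSmooth (d : ℤ) (u : ℝ × Space → ℝ) : Prop where
  smooth : ContDiffOn ℝ ∞ u {0}ᶜ
  homog : ∀ c : ℝ, 0 < c → ∀ p, p ≠ 0 → u (c • p) = c ^ d * u p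

lemma dirDeriv_congr {u w : ℝ × Space → ℝ} (h : ∀ p, p ≠ 0 → u p = w p) (e : ℝ × Space) :
    ∀ p, p ≠ 0 → dirDeriv e u p = dirDeriv e w p := by
  intro p hp
  have : u =ᶠ[nhds p] w :=
    Filter.eventuallyEq_of_mem (isOpen_compl_singleton.mem_nhds hp) (fun q hq => h q hq)
  rw [dirDeriv, dirDeriv, this.fderiv_eq]

namespace HomogSmooth

variable {d : ℤ} {u w : ℝ × Space → ℝ}

lemma contDiffAt (hu : HomogSmooth d u) {p : ℝ × Space} (hp : p ≠ 0) : ContDiffAt ℝ ∞ u p :=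
  hu.smooth.contDiffAt (isOpen_compl_singleton.mem_nhds hp)

lemma differentiableAt (hu : HomogSmooth d u) {p : ℝ × Space} (hp : p ≠ 0) :
    DifferentiableAt ℝ u p :=
  (hu.contDiffAt hp).differentiableAt (by simp)

lemma add (hu : HomogSmooth d u) (hw : HomogSmooth d w) : HomogSmooth d (fun p => u p + w p) :=
  ⟨hu.smooth.add hw.smooth, fun c hc p hp => by
    rw [hu.homog c hc p hp, hw.homog c hc p hp]; ring⟩

lemma const_mul (hu : HomogSmooth d u) (r : ℝ) : HomogSmooth d (fun p => r * u p) :=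
  ⟨contDiffOn_const.mul hu.smooth, fun c hc p hp => by rw [hu.homog c hc p hp]; ring⟩

lemma dirDeriv (hu : HomogSmooth d u) (e : ℝ × Space) :
    HomogSmooth (d - 1) (dirDeriv e u) := by
  refine ⟨(hu.smooth.fderiv_of_isOpen isOpen_compl_singleton (by simp)).clm_apply
    contDiffOn_const, fun c hc p hp => ?_⟩
  have hcp : c • p ≠ 0 := smul_ne_zero hc.ne' hp
  have h1 : HasFDerivAt (fun q => u (c • q)) (c • fderiv ℝ u (c • p)) p := by
    have := (hu.differentiableAt hcp).hasFDerivAt.comp p ((hasFDerivAt_id p).const_smul c)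
    refine this.congr_fderiv ?_
    ext <;> simp
  have h2 : HasFDerivAt (fun q => u (c • q)) (c ^ d • fderiv ℝ u p) p := by
    refine ((hu.differentiableAt hp).hasFDerivAt.const_smul (c ^ d)).congr_of_eventuallyEq ?_
    exact Filter.eventuallyEq_of_mem (isOpen_compl_singleton.mem_nhds hp)
      (fun q hq => hu.homog c hc q hq)
  have h3 := DFunLike.congr_fun (h1.unique h2) e
  simp only [smul_apply, smul_eq_mul] at h3
  simp only [MeanFieldDynamo.dirDeriv]
  rw [zpow_sub_one₀ hc.ne', mul_right_comm, ← h3]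
  field_simp

lemma dirDeriv_comm (hu : HomogSmooth d u) (e e' : ℝ × Space) {p : ℝ × Space} (hp : p ≠ 0) :
    MeanFieldDynamo.dirDeriv e (MeanFieldDynamo.dirDeriv e' u) p =
      MeanFieldDynamo.dirDeriv e' (MeanFieldDynamo.dirDeriv e u) p := by
  have h : ContDiffAt ℝ ∞ u p := hu.contDiffAt hp
  have hd : DifferentiableAt ℝ (fderiv ℝ u) p :=
    (h.fderiv_right (m := ∞) (by simp)).differentiableAt (by simp)
  have key (a b : ℝ × Space) : MeanFieldDynamo.dirDeriv a (MeanFieldDynamo.dirDeriv b u) p =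
      fderiv ℝ (fderiv ℝ u) p a b := by
    simp only [MeanFieldDynamo.dirDeriv]
    change fderiv ℝ (fun q => fderiv ℝ u q b) p a = _
    rw [fderiv_clm_apply hd (differentiableAt_const b)]
    simp
  rw [key, key]
  refine (h.isSymmSndFDerivAt ?_) e e'
  rw [minSmoothness_of_isRCLikeNormedField]
  exact WithTop.coe_le_coe.2 le_top

/-- Euler's identity on the axis. -/
lemma fderiv_radial (hu : HomogSmooth d u) : fderiv ℝ u (1, 0) (1, 0) = d * u (1, 0) := by
  have hp : ((1, 0) : ℝ × Space) ≠ 0 := by simp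
  have h1 : HasDerivAt (fun c : ℝ => u (c • ((1, 0) : ℝ × Space)))
      (fderiv ℝ u (1, 0) (1, 0)) 1 := by
    have h := (hasDerivAt_id (1 : ℝ)).smul_const ((1, 0) : ℝ × Space)
    have h' : HasFDerivAt u (fderiv ℝ u (1, 0)) ((id (1 : ℝ)) • ((1, 0) : ℝ × Space)) := by
      simpa using! (hu.differentiableAt hp).hasFDerivAt
    have := h'.comp_hasDerivAt 1 h
    simpa using! this
  have h2 : HasDerivAt (fun c : ℝ => u (c • ((1, 0) : ℝ × Space))) (d * u (1, 0)) 1 := by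
    have h := (hasDerivAt_zpow d (1 : ℝ) (Or.inl one_ne_zero)).mul_const (u (1, 0))
    refine (h.congr_of_eventuallyEq ?_).congr_deriv (by simp)
    exact Filter.eventuallyEq_of_mem (Ioi_mem_nhds one_pos) (fun c hc => hu.homog c hc _ hp)
  exact h1.unique h2

lemma exists_bound (hu : HomogSmooth d u) : ∃ K, ∀ p, p ≠ 0 → |u p| ≤ K * ‖p‖ ^ d := by
  have hc : ContinuousOn u (Metric.sphere 0 1) := hu.smooth.continuousOn.mono (by
    intro p hp h0
    rw [mem_singleton_iff] at h0
    simp [h0] at hp)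
  obtain ⟨K, hK⟩ := (isCompact_sphere (0 : ℝ × Space) 1).exists_bound_of_continuousOn hc
  refine ⟨K, fun p hp => ?_⟩
  have hn : 0 < ‖p‖ := norm_pos_iff.2 hp
  have h1 := hu.homog ‖p‖ hn (‖p‖⁻¹ • p) (smul_ne_zero (inv_ne_zero hn.ne') hp)
  rw [smul_smul, mul_inv_cancel₀ hn.ne', one_smul] at h1
  rw [h1, abs_mul, abs_of_pos (zpow_pos hn d), mul_comm]
  refine mul_le_mul_of_nonneg_right ?_ (zpow_pos hn d).le
  refine hK _ ?_
  simp [norm_smul, hn.ne']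

end HomogSmooth

/-- The unit vector of the first factor of `ℝ × ℝ³`. -/
def dir0 : ℝ × Space := (1, 0)

/-- The unit vectors of the second factor of `ℝ × ℝ³`. -/
def dir (j : Fin 3) : ℝ × Space := (0, EuclideanSpace.single j 1)

/-- The Newtonian kernel of `ℝ⁴`, up to a constant factor, and its derivatives along the first
factor. -/
def kernelDeriv : ℕ → ℝ × Space → ℝ
  | 0 => fun p => (p.1 ^ 2 + ‖p.2‖ ^ 2)⁻¹
  | n + 1 => dirDeriv dir0 (kernelDeriv n)

lemma sq_add_norm_sq_ne_zero {p : ℝ × Space} (hp : p ≠ 0) : p.1 ^ 2 + ‖p.2‖ ^ 2 ≠ 0 := by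
  intro h
  apply hp
  have h1 : p.1 = 0 := by nlinarith [sq_nonneg p.1, sq_nonneg ‖p.2‖]
  have h2 : ‖p.2‖ = 0 := by nlinarith [sq_nonneg p.1, sq_nonneg ‖p.2‖]
  exact Prod.ext h1 (norm_eq_zero.1 h2)

lemma homogSmooth_kernelDeriv (n : ℕ) : HomogSmooth (-2 - n) (kernelDeriv n) := by
  induction n with
  | zero =>
    refine ⟨?_, fun c hc p hp => ?_⟩
    · refine ContDiffOn.inv (ContDiff.contDiffOn ?_) (fun p hp => sq_add_norm_sq_ne_zero hp)
      exact (contDiff_fst.pow 2).add (contDiff_snd.norm_sq ℝ)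
    · have := sq_add_norm_sq_ne_zero hp
      simp only [kernelDeriv, Prod.smul_fst, Prod.smul_snd, norm_smul, smul_eq_mul,
        Real.norm_eq_abs, mul_pow, sq_abs]
      rw [← mul_add, mul_inv]
      simp [zpow_neg]
  | succ n ih =>
    have := ih.dirDeriv dir0
    rw [show (-2 - (n : ℤ) - 1) = -2 - ((n + 1 : ℕ) : ℤ) by push_cast; ring] at this
    exact this

lemma dirDeriv_kernel_zero (e : ℝ × Space) {p : ℝ × Space} (hp : p ≠ 0) :
    dirDeriv e (kernelDeriv 0) p =
      (-2) * (p.1 * e.1 + inner ℝ p.2 e.2) * (kernelDeriv 0 p) ^ 2 := by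
  have hne := sq_add_norm_sq_ne_zero hp
  have h1 : HasFDerivAt (fun q : ℝ × Space => q.1) (ContinuousLinearMap.fst ℝ ℝ Space) p :=
    hasFDerivAt_fst
  have h2 : HasFDerivAt (fun q : ℝ × Space => q.2) (ContinuousLinearMap.snd ℝ ℝ Space) p :=
    hasFDerivAt_snd
  have h := ((hasDerivAt_inv hne).comp_hasFDerivAt p ((h1.pow 2).add h2.norm_sq))
  have h' : dirDeriv e (kernelDeriv 0) p = _ := congrArg (fun L => L e) h.fderiv
  rw [h']
  simp [kernelDeriv]
  field_simp
  ring

lemma dirDeriv_dirDeriv_kernel_zero (e : ℝ × Space) {p : ℝ × Space} (hp : p ≠ 0) :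
    dirDeriv e (dirDeriv e (kernelDeriv 0)) p =
      (-2) * (e.1 * e.1 + inner ℝ e.2 e.2) * (kernelDeriv 0 p) ^ 2 +
      8 * (p.1 * e.1 + inner ℝ p.2 e.2) ^ 2 * (kernelDeriv 0 p) ^ 3 := by
  rw [dirDeriv_congr (fun q hq => dirDeriv_kernel_zero e hq) e p hp]
  have h1 : HasFDerivAt (fun q : ℝ × Space => q.1) (ContinuousLinearMap.fst ℝ ℝ Space) p :=
    hasFDerivAt_fst
  have h2 : HasFDerivAt (fun q : ℝ × Space => q.2) (ContinuousLinearMap.snd ℝ ℝ Space) p :=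
    hasFDerivAt_snd
  have h3 := (((h1.mul_const e.1).add (h2.inner ℝ (hasFDerivAt_const e.2 p))).const_mul
    (-2)).mul ((((homogSmooth_kernelDeriv 0).differentiableAt hp).hasFDerivAt).pow 2)
  have h' : dirDeriv e (fun q : ℝ × Space => (-2) * (q.1 * e.1 + inner ℝ q.2 e.2) *
    (kernelDeriv 0 q) ^ 2) p = _ := congrArg (fun L => L e) h3.fderiv
  have h4 := dirDeriv_kernel_zero e hp
  simp only [dirDeriv] at h4
  rw [h']
  simp [h4, real_inner_comm]
  ring

lemma dirDeriv_dirDeriv_kernelDeriv_succ (e : ℝ × Space) (n : ℕ) {p : ℝ × Space} (hp : p ≠ 0) :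
    dirDeriv e (dirDeriv e (kernelDeriv (n + 1))) p =
      dirDeriv dir0 (dirDeriv e (dirDeriv e (kernelDeriv n))) p := by
  have hn := homogSmooth_kernelDeriv n
  rw [kernelDeriv, dirDeriv_congr (fun q hq => hn.dirDeriv_comm e dir0 hq) e p hp,
    (hn.dirDeriv e).dirDeriv_comm e dir0 hp]

/-- The functions `kernelDeriv n` are harmonic: derivatives along the first factor commute with the
Laplacian. -/
lemma kernelDeriv_harmonic (n : ℕ) {p : ℝ × Space} (hp : p ≠ 0) :
    dirDeriv dir0 (dirDeriv dir0 (kernelDeriv n)) p +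
      ∑ j, dirDeriv (dir j) (dirDeriv (dir j) (kernelDeriv n)) p = 0 := by
  induction n generalizing p with
  | zero =>
    have hne := sq_add_norm_sq_ne_zero hp
    have h0 : ‖p.2‖ ^ 2 = p.2 0 ^ 2 + p.2 1 ^ 2 + p.2 2 ^ 2 := by
      rw [EuclideanSpace.norm_sq_eq]; simp [Fin.sum_univ_three]
    simp only [dirDeriv_dirDeriv_kernel_zero _ hp]
    simp [dir0, dir, Fin.sum_univ_three, EuclideanSpace.inner_single_right, kernelDeriv]
    field_simp
    rw [h0]
    ring
  | succ n ih =>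
    have hn := homogSmooth_kernelDeriv n
    have h (e : ℝ × Space) : DifferentiableAt ℝ (dirDeriv e (dirDeriv e (kernelDeriv n))) p :=
      ((hn.dirDeriv e).dirDeriv e).differentiableAt hp
    simp only [dirDeriv_dirDeriv_kernelDeriv_succ _ n hp]
    have h1 := dirDeriv_congr (w := fun _ => 0) (fun q hq => ih hq) dir0 p hp
    have h2 : dirDeriv dir0 (fun _ => (0 : ℝ)) p = 0 := by simp [dirDeriv]
    rw [h2] at h1
    rw [← h1]
    simp only [Fin.sum_univ_three]
    nth_rewrite 5 [dirDeriv]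
    rw [fderiv_fun_add (h _) (((h _).fun_add (h _)).fun_add (h _)),
      fderiv_fun_add ((h _).fun_add (h _)) (h _), fderiv_fun_add (h _) (h _)]
    rfl

/-- On the axis, the derivative along the first factor multiplies a homogeneous function by its
degree, so the nonvanishing of this second derivative passes from `n` to `n + 1`. -/
lemma kernelDeriv_axis_ne_zero (n : ℕ) :
    dirDeriv (dir 0) (dirDeriv (dir 0) (kernelDeriv n)) (1, 0) +
      dirDeriv (dir 1) (dirDeriv (dir 1) (kernelDeriv n)) (1, 0) ≠ 0 := by
  have hp : ((1, 0) : ℝ × Space) ≠ 0 := by simp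
  induction n with
  | zero =>
    rw [dirDeriv_dirDeriv_kernel_zero _ hp, dirDeriv_dirDeriv_kernel_zero _ hp]
    simp [dir, kernelDeriv]
  | succ n ih =>
    rw [dirDeriv_dirDeriv_kernelDeriv_succ _ n hp, dirDeriv_dirDeriv_kernelDeriv_succ _ n hp]
    have hn := homogSmooth_kernelDeriv n
    have h (e : ℝ × Space) := ((hn.dirDeriv e).dirDeriv e).fderiv_radial
    simp only [dirDeriv] at h ih ⊢
    simp only [dir0]
    rw [h, h, ← mul_add]
    refine mul_ne_zero ?_ ih
    push_cast
    have : (0 : ℝ) ≤ n := n.cast_nonneg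
    intro h0
    linarith

/-! ### Finite-energy solutions with constant coefficients -/

/-- The components of the vector field `(-∂₀ + σ ∇ ×) ∇ × (u e₃)` on `ℝ × ℝ³`, where `∂₀` is the
derivative along the first factor and `u` is the `n`-th derivative of the Newtonian kernel. -/
def beltramiComp (σ : ℝ) (n : ℕ) (i : Fin 3) (p : ℝ × Space) : ℝ :=
  let D := fun e e' : ℝ × Space => dirDeriv e (dirDeriv e' (kernelDeriv n)) p
  ![-1 * D dir0 (dir 1) + σ * D (dir 0) (dir 2), D dir0 (dir 0) + σ * D (dir 1) (dir 2),
    -σ * (D (dir 0) (dir 0) + D (dir 1) (dir 1))] i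

/-- The vector field with components `beltramiComp`. -/
def beltramiField (σ : ℝ) (n : ℕ) (p : ℝ × Space) : Space :=
  WithLp.toLp 2 fun i => beltramiComp σ n i p

lemma homogSmooth_beltramiComp (σ : ℝ) (n : ℕ) (i : Fin 3) :
    HomogSmooth (-4 - n) (beltramiComp σ n i) := by
  have h (e e' : ℝ × Space) :
      HomogSmooth (-4 - n) (dirDeriv e (dirDeriv e' (kernelDeriv n))) := by
    have := ((homogSmooth_kernelDeriv n).dirDeriv e').dirDeriv e
    rwa [show (-2 - (n : ℤ) - 1 - 1) = -4 - n by ring] at this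
  fin_cases i
  · exact ((h _ _).const_mul _).add ((h _ _).const_mul _)
  · exact (h _ _).add ((h _ _).const_mul _)
  · exact ((h _ _).add (h _ _)).const_mul _

lemma contDiffOn_beltramiField (σ : ℝ) (n : ℕ) : ContDiffOn ℝ ∞ (beltramiField σ n) {0}ᶜ :=
  contDiffOn_euclidean.2 fun i => (homogSmooth_beltramiComp σ n i).smooth

lemma differentiableAt_beltramiField (σ : ℝ) (n : ℕ) {p : ℝ × Space} (hp : p ≠ 0) :
    DifferentiableAt ℝ (beltramiField σ n) p :=
  ((contDiffOn_beltramiField σ n).contDiffAt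
    (isOpen_compl_singleton.mem_nhds hp)).differentiableAt (by simp)

lemma fderiv_beltramiField (σ : ℝ) (n : ℕ) {p : ℝ × Space} (hp : p ≠ 0) (e : ℝ × Space)
    (i : Fin 3) : fderiv ℝ (beltramiField σ n) p e i = dirDeriv e (beltramiComp σ n i) p := by
  have h : HasFDerivAt (beltramiComp σ n i)
      ((EuclideanSpace.proj i : Space →L[ℝ] ℝ).comp (fderiv ℝ (beltramiField σ n) p)) p :=
    (EuclideanSpace.proj i : Space →L[ℝ] ℝ).hasFDerivAt.comp p
      (differentiableAt_beltramiField σ n hp).hasFDerivAt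
  rw [dirDeriv, h.fderiv]
  rfl

lemma beltramiField_smul (σ : ℝ) (n : ℕ) {c : ℝ} (hc : 0 < c) {p : ℝ × Space} (hp : p ≠ 0) :
    beltramiField σ n (c • p) = c ^ (-4 - n : ℤ) • beltramiField σ n p := by
  ext i
  exact (homogSmooth_beltramiComp σ n i).homog c hc p hp

/-- The components of the equations `∂₀ b = -σ ∇ × b` and `∇ · b = 0` for `beltramiField`. -/
lemma beltramiComp_equations {σ : ℝ} (hσ : σ ^ 2 = 1) (n : ℕ) {p : ℝ × Space} (hp : p ≠ 0) :
    let b := fun e i => dirDeriv e (beltramiComp σ n i) p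
    b dir0 0 = -σ * (b (dir 1) 2 - b (dir 2) 1) ∧ b dir0 1 = -σ * (b (dir 2) 0 - b (dir 0) 2) ∧
      b dir0 2 = -σ * (b (dir 0) 1 - b (dir 1) 0) ∧
      b (dir 0) 0 + b (dir 1) 1 + b (dir 2) 2 = 0 := by
  set u := kernelDeriv n with hu
  have hn : HomogSmooth (-2 - n) u := homogSmooth_kernelDeriv n
  have hd (a b : ℝ × Space) : DifferentiableAt ℝ (dirDeriv a (dirDeriv b u)) p :=
    ((hn.dirDeriv b).dirDeriv a).differentiableAt hp
  have c12 (a b c : ℝ × Space) : dirDeriv a (dirDeriv b (dirDeriv c u)) p =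
      dirDeriv b (dirDeriv a (dirDeriv c u)) p := (hn.dirDeriv c).dirDeriv_comm a b hp
  have c23 (a b c : ℝ × Space) : dirDeriv a (dirDeriv b (dirDeriv c u)) p =
      dirDeriv a (dirDeriv c (dirDeriv b u)) p :=
    dirDeriv_congr (fun q hq => hn.dirDeriv_comm b c hq) a p hp
  have b0 (e : ℝ × Space) : dirDeriv e (beltramiComp σ n 0) p =
      -1 * dirDeriv e (dirDeriv dir0 (dirDeriv (dir 1) u)) p +
        σ * dirDeriv e (dirDeriv (dir 0) (dirDeriv (dir 2) u)) p := by
    have := (((hd dir0 (dir 1)).hasFDerivAt.const_mul (-1)).add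
      ((hd (dir 0) (dir 2)).hasFDerivAt.const_mul σ)).fderiv
    exact congrArg (fun L => L e) this
  have b1 (e : ℝ × Space) : dirDeriv e (beltramiComp σ n 1) p =
      dirDeriv e (dirDeriv dir0 (dirDeriv (dir 0) u)) p +
        σ * dirDeriv e (dirDeriv (dir 1) (dirDeriv (dir 2) u)) p := by
    have := ((hd dir0 (dir 0)).hasFDerivAt.add
      ((hd (dir 1) (dir 2)).hasFDerivAt.const_mul σ)).fderiv
    exact congrArg (fun L => L e) this
  have b2 (e : ℝ × Space) : dirDeriv e (beltramiComp σ n 2) p =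
      -σ * (dirDeriv e (dirDeriv (dir 0) (dirDeriv (dir 0) u)) p +
        dirDeriv e (dirDeriv (dir 1) (dirDeriv (dir 1) u)) p) := by
    have := (((hd (dir 0) (dir 0)).hasFDerivAt.add
      (hd (dir 1) (dir 1)).hasFDerivAt).const_mul (-σ)).fderiv
    exact congrArg (fun L => L e) this
  have har (e : ℝ × Space) : dirDeriv e (dirDeriv dir0 (dirDeriv dir0 u)) p +
      dirDeriv e (dirDeriv (dir 0) (dirDeriv (dir 0) u)) p +
      dirDeriv e (dirDeriv (dir 1) (dirDeriv (dir 1) u)) p +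
      dirDeriv e (dirDeriv (dir 2) (dirDeriv (dir 2) u)) p = 0 := by
    have h1 := dirDeriv_congr (w := fun _ => 0) (fun q hq => kernelDeriv_harmonic n hq) e p hp
    have h2 : dirDeriv e (fun _ => (0 : ℝ)) p = 0 := by simp [dirDeriv]
    rw [h2] at h1
    simp only [Fin.sum_univ_three] at h1
    have h3 := ((hd dir0 dir0).hasFDerivAt.add (((hd (dir 0) (dir 0)).hasFDerivAt.add
      (hd (dir 1) (dir 1)).hasFDerivAt).add (hd (dir 2) (dir 2)).hasFDerivAt)).fderiv
    have h4 := congrArg (fun L => L e) h3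
    have h5 : dirDeriv e (dirDeriv dir0 (dirDeriv dir0 u)) p +
      ((dirDeriv e (dirDeriv (dir 0) (dirDeriv (dir 0) u)) p +
      dirDeriv e (dirDeriv (dir 1) (dirDeriv (dir 1) u)) p) +
      dirDeriv e (dirDeriv (dir 2) (dirDeriv (dir 2) u)) p) = 0 := h4.symm.trans h1
    linarith
  intro b
  simp only [b, b0, b1, b2]
  refine ⟨?_, ?_, ?_, ?_⟩
  · have := har (dir 1)
    rw [c12 (dir 1) dir0, c23 dir0 (dir 1) dir0] at this
    rw [c12 (dir 2) dir0 (dir 0), c23 dir0 (dir 2) (dir 0), c12 (dir 2) (dir 1) (dir 2)]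
    linear_combination -this + (dirDeriv (dir 1) (dirDeriv (dir 0) (dirDeriv (dir 0) u)) p +
      dirDeriv (dir 1) (dirDeriv (dir 1) (dirDeriv (dir 1) u)) p +
      dirDeriv (dir 1) (dirDeriv (dir 2) (dirDeriv (dir 2) u)) p) * (-hσ)
  · have := har (dir 0)
    rw [c12 (dir 0) dir0, c23 dir0 (dir 0) dir0] at this
    rw [c12 (dir 2) dir0 (dir 1), c23 dir0 (dir 2) (dir 1), c12 (dir 2) (dir 0) (dir 2)]
    linear_combination this + (dirDeriv (dir 0) (dirDeriv (dir 0) (dirDeriv (dir 0) u)) p +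
      dirDeriv (dir 0) (dirDeriv (dir 1) (dirDeriv (dir 1) u)) p +
      dirDeriv (dir 0) (dirDeriv (dir 2) (dirDeriv (dir 2) u)) p) * hσ
  · rw [c12 (dir 0) dir0, c12 (dir 1) dir0, c12 (dir 0) (dir 1)]
    ring
  · rw [c12 (dir 0) dir0, c12 (dir 1) dir0, c23 dir0 (dir 1), c12 (dir 2) (dir 0),
      c23 (dir 0) (dir 2), c12 (dir 2) (dir 1), c23 (dir 1) (dir 2)]
    ring

/-- A solution of the dynamo system with the constants `v`, `α`, transported with the velocity `v`
and singular at the time `T`. -/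
def concentratingField (v : Space) (α T : ℝ) (n : ℕ) (t : ℝ) (x : Space) : Space :=
  beltramiField (SignType.sign α) n (|α| * (T - t), x - t • v)

lemma concentratingField_point_ne_zero {α T t : ℝ} (hα : α ≠ 0) (ht : t < T) (x : Space) :
    ((|α| * (T - t), x) : ℝ × Space) ≠ 0 := by
  intro h
  have h1 := congrArg Prod.fst h
  simp only [Prod.fst_zero, mul_eq_zero, abs_eq_zero] at h1
  rcases h1 with h1 | h1
  · exact hα h1
  · linarith

lemma smoothOn_concentratingField (v : Space) {α : ℝ} (hα : α ≠ 0) (T : ℝ) (n : ℕ) :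
    SmoothOn T (concentratingField v α T n) := by
  have h : ContDiff ℝ ∞ (fun p : ℝ × Space => (|α| * (T - p.1), p.2 - p.1 • v)) := by fun_prop
  refine (contDiffOn_beltramiField _ n).comp h.contDiffOn (fun p hp => ?_)
  exact concentratingField_point_ne_zero hα hp.1.2 _

lemma pd_concentratingField (v : Space) {α : ℝ} (hα : α ≠ 0) {T t : ℝ} (ht : t < T) (n : ℕ)
    (x : Space) (i j : Fin 3) :
    pd j (concentratingField v α T n t) x i =
      dirDeriv (dir j) (beltramiComp (SignType.sign α) n i) (|α| * (T - t), x - t • v) := by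
  have hp := concentratingField_point_ne_zero hα ht (x - t • v)
  have h1 : HasFDerivAt (fun y : Space => ((|α| * (T - t), y - t • v) : ℝ × Space))
      (ContinuousLinearMap.inr ℝ ℝ Space) x := by
    have := (hasFDerivAt_const (|α| * (T - t)) x).prodMk
      ((hasFDerivAt_id (𝕜 := ℝ) x).sub_const (t • v))
    exact this
  have h2 := (differentiableAt_beltramiField (SignType.sign α) n hp).hasFDerivAt.comp x h1
  rw [← fderiv_beltramiField _ n hp, pd]
  have h3 : fderiv ℝ (concentratingField v α T n t) x = _ := h2.fderiv
  rw [h3]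
  rfl

lemma inductionEq_concentratingField (v : Space) {α : ℝ} (hα : α ≠ 0) (T : ℝ) (n : ℕ) :
    InductionEq (Ioo 0 T) (fun _ _ => v) (fun _ _ => α) (concentratingField v α T n) := by
  intro t ht x
  have hp := concentratingField_point_ne_zero hα ht.2 (x - t • v)
  have h1 : HasDerivAt (fun s : ℝ => ((|α| * (T - s), x - s • v) : ℝ × Space)) (-|α|, -v) t := by
    have h3 := (((hasDerivAt_id t).const_sub T).const_mul |α|).prodMk
      (((hasDerivAt_id t).smul_const v).const_sub x)
    simpa using! h3
  have h2 := (differentiableAt_beltramiField (SignType.sign α) n hp).hasFDerivAt.comp_hasDerivAt t h1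
  refine h2.congr_deriv ?_
  have hx : DifferentiableAt ℝ (concentratingField v α T n t) x :=
    ((smoothOn_concentratingField v hα T n).slice ⟨ht.1.le, ht.2⟩).differentiable (by simp) x
  have hv : ((-|α|, -v) : ℝ × Space) = (-|α|) • dir0 + ((-v 0) • dir 0 + (-v 1) • dir 1
      + (-v 2) • dir 2) := by
    refine Prod.ext (by simp [dir0, dir]) ?_
    ext i; fin_cases i <;> simp [dir0, dir]
  have hσ : ((SignType.sign α : SignType) : ℝ) ^ 2 = 1 := by
    rcases lt_or_gt_of_ne hα with h | h <;> simp [h]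
  have hα' : |α| * (SignType.sign α : SignType) = α := by
    rcases lt_or_gt_of_ne hα with h | h <;> simp [h, abs_of_neg, abs_of_pos]
  obtain ⟨e0, e1, e2, ed⟩ := beltramiComp_equations hσ n hp
  ext i
  rw [dynamoOp_const hx, hv, map_add, map_add, map_add, map_smul, map_smul, map_smul, map_smul]
  simp only [PiLp.add_apply, PiLp.smul_apply, fderiv_beltramiField _ n hp,
    pd_concentratingField v hα ht.2]
  generalize hD : (fun e i => dirDeriv e (beltramiComp (SignType.sign α) n i)
    (|α| * (T - t), x - t • v)) = D at e0 e1 e2 ed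
  have hD' (e : ℝ × Space) (i : Fin 3) : dirDeriv e (beltramiComp (SignType.sign α) n i)
    (|α| * (T - t), x - t • v) = D e i := by rw [← hD]
  simp only [hD']
  fin_cases i <;> simp [dynamoMatrix, cross, Fin.sum_univ_three]
  · rw [e0]
    linear_combination (D (dir 1) 2 - D (dir 2) 1) * hα' - v 0 * ed
  · rw [e1]
    linear_combination (D (dir 2) 0 - D (dir 0) 2) * hα' - v 1 * ed
  · rw [e2]
    linear_combination (D (dir 0) 1 - D (dir 1) 0) * hα' - v 2 * ed

lemma div_concentratingField (v : Space) {α : ℝ} (hα : α ≠ 0) {T t : ℝ} (ht : t < T) (n : ℕ)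
    (x : Space) : div (concentratingField v α T n t) x = 0 := by
  have hp := concentratingField_point_ne_zero hα ht (x - t • v)
  have hσ : ((SignType.sign α : SignType) : ℝ) ^ 2 = 1 := by
    rcases lt_or_gt_of_ne hα with h | h <;> simp [h]
  simp only [div, pd_concentratingField v hα ht, Fin.sum_univ_three]
  exact (beltramiComp_equations hσ n hp).2.2.2

lemma memLp_beltramiField (σ : ℝ) (n : ℕ) :
    MemLp (fun x => beltramiField σ n (1, x)) 2 volume := by
  have hne (x : Space) : ((1, x) : ℝ × Space) ≠ 0 := by simp
  have hcont : Continuous (fun x : Space => beltramiField σ n (1, x)) :=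
    (contDiffOn_beltramiField σ n).continuousOn.comp_continuous (by fun_prop) hne
  rw [memLp_two_iff_integrable_sq_norm hcont.aestronglyMeasurable]
  choose K hK using fun i => (homogSmooth_beltramiComp σ n i).exists_bound
  have hint : Integrable (fun x : Space => ∑ i, K i ^ 2 * 2 ^ 4 * (1 + ‖x‖) ^ (-4 : ℝ)) volume :=
    integrable_finsetSum _ fun i _ =>
      (integrable_one_add_norm (by simp; norm_num)).const_mul _
  refine hint.mono' (hcont.norm.pow 2).aestronglyMeasurable (Filter.Eventually.of_forall fun x => ?_)
  rw [Real.norm_of_nonneg (by positivity), EuclideanSpace.norm_sq_eq]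
  refine Finset.sum_le_sum fun i _ => ?_
  have hN1 : 1 ≤ ‖((1, x) : ℝ × Space)‖ := by simp [Prod.norm_def]
  have hN2 : (1 + ‖x‖) / 2 ≤ ‖((1, x) : ℝ × Space)‖ := by
    simp only [Prod.norm_def, norm_one]
    have h1 := le_max_left 1 ‖x‖
    have h2 := le_max_right 1 ‖x‖
    linarith
  set N := ‖((1, x) : ℝ × Space)‖
  have hN0 : 0 < N := by linarith
  have hb := hK i (1, x) (hne x)
  have hz : N ^ (-4 - n : ℤ) ≤ N ^ (-2 : ℤ) := zpow_le_zpow_right₀ hN1 (by omega)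
  have hq : (N ^ (-2 : ℤ)) ^ 2 ≤ 2 ^ 4 * (1 + ‖x‖) ^ (-4 : ℝ) := by
    have h1 : (0 : ℝ) < 1 + ‖x‖ := by positivity
    have h2 : (1 + ‖x‖) ^ (-4 : ℝ) = ((1 + ‖x‖) ^ 4)⁻¹ := by
      rw [Real.rpow_neg h1.le]; norm_cast
    rw [h2, zpow_neg, inv_pow]
    have h3 : ((1 + ‖x‖) / 2) ^ 4 ≤ N ^ 4 := by gcongr
    have h4 := inv_anti₀ (by positivity) h3
    calc ((N ^ (2 : ℤ)) ^ 2)⁻¹ = (N ^ 4)⁻¹ := by norm_cast; rw [← pow_mul]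
      _ ≤ _ := h4
      _ = _ := by rw [div_pow, inv_div]; ring
  rw [Real.norm_eq_abs]
  calc |beltramiField σ n (1, x) i| ^ 2 ≤ (K i * N ^ (-4 - n : ℤ)) ^ 2 :=
        pow_le_pow_left₀ (abs_nonneg _) hb 2
    _ = K i ^ 2 * (N ^ (-4 - n : ℤ)) ^ 2 := by ring
    _ ≤ K i ^ 2 * (N ^ (-2 : ℤ)) ^ 2 := by gcongr
    _ ≤ K i ^ 2 * (2 ^ 4 * (1 + ‖x‖) ^ (-4 : ℝ)) := by gcongr
    _ = _ := by ring

lemma normL2_beltramiField_ne_zero {σ : ℝ} (hσ : σ ≠ 0) (n : ℕ) :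
    normL2 (fun x => beltramiField σ n (1, x)) ≠ 0 := by
  have hne (x : Space) : ((1, x) : ℝ × Space) ≠ 0 := by simp
  have hcont : Continuous (fun x : Space => beltramiField σ n (1, x)) :=
    (contDiffOn_beltramiField σ n).continuousOn.comp_continuous (by fun_prop) hne
  rw [normL2, Ne, eLpNorm_eq_zero_iff hcont.aestronglyMeasurable (by simp)]
  intro h
  have h0 := (Continuous.ae_eq_iff_eq volume hcont continuous_zero).1 h
  have h1 := congrArg (fun y : Space => y 2) (congrFun h0 0)
  refine mul_ne_zero (neg_ne_zero.2 hσ) (kernelDeriv_axis_ne_zero n) ?_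
  exact h1

lemma normL2_comp_smul {f : Space → Space} (hf : Continuous f) {c : ℝ} (hc : 0 < c) :
    normL2 (fun x => f (c⁻¹ • x)) = ENNReal.ofReal (c ^ (3 / 2 : ℝ)) * normL2 f := by
  have h1 := eLpNorm_map_measure (p := 2) (g := f) (f := fun x : Space => c⁻¹ • x) (μ := volume)
    hf.aestronglyMeasurable (by fun_prop)
  rw [normL2, show (fun x => f (c⁻¹ • x)) = f ∘ fun x => c⁻¹ • x from rfl, ← h1]
  have h2 := Measure.map_addHaar_smul (volume : Measure Space) (inv_ne_zero hc.ne')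
  rw [show Measure.map (fun x : Space => c⁻¹ • x) volume = _ from h2,
    eLpNorm_smul_measure_of_ne_top (by simp), normL2, smul_eq_mul]
  congr 1
  rw [ENNReal.ofReal_rpow_of_nonneg (by positivity) (by simp)]
  congr 1
  simp only [finrank_euclideanSpace, Fintype.card_fin, inv_pow, inv_inv]
  rw [abs_of_pos (by positivity), ← Real.rpow_natCast, ← Real.rpow_mul hc.le]
  congr 1
  norm_num

lemma normL2_comp_sub (f : Space → Space) (hf : Continuous f) (a : Space) :
    normL2 (fun x => f (x - a)) = normL2 f :=
  eLpNorm_comp_measurePreserving hf.aestronglyMeasurable (measurePreserving_sub_right volume a)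

lemma beltramiField_eq_smul (σ : ℝ) (n : ℕ) {c : ℝ} (hc : 0 < c) (x : Space) :
    beltramiField σ n (c, x) = c ^ (-4 - n : ℤ) • beltramiField σ n (1, c⁻¹ • x) := by
  rw [← beltramiField_smul σ n hc (by simp)]
  simp [hc.ne', smul_smul]

lemma continuous_beltramiField (σ : ℝ) (n : ℕ) {c : ℝ} (hc : 0 < c) :
    Continuous (fun x : Space => beltramiField σ n (c, x)) :=
  (contDiffOn_beltramiField σ n).continuousOn.comp_continuous (by fun_prop)
    (fun x => by simp [hc.ne'])

lemma normL2_beltramiField (σ : ℝ) (n : ℕ) {c : ℝ} (hc : 0 < c) :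
    normL2 (fun x => beltramiField σ n (c, x)) =
      ENNReal.ofReal (c ^ (-4 - n : ℤ) * c ^ (3 / 2 : ℝ)) *
        normL2 (fun x => beltramiField σ n (1, x)) := by
  have h1 := normL2_comp_smul (continuous_beltramiField σ n one_pos) hc
  have h2 : (fun x => beltramiField σ n (c, x)) =
      c ^ (-4 - n : ℤ) • fun x => beltramiField σ n (1, c⁻¹ • x) := by
    funext x; exact beltramiField_eq_smul σ n hc x
  rw [h2, normL2, eLpNorm_const_smul]
  rw [normL2] at h1
  rw [h1, ENNReal.ofReal_mul (by positivity), mul_assoc, Real.enorm_eq_ofReal (by positivity)]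

lemma normL2_concentratingField (v : Space) {α : ℝ} (hα : α ≠ 0) {T t : ℝ} (ht : t < T) (n : ℕ) :
    normL2 (concentratingField v α T n t) =
      ENNReal.ofReal ((|α| * (T - t)) ^ (-4 - n : ℤ) * (|α| * (T - t)) ^ (3 / 2 : ℝ)) *
        normL2 (fun x => beltramiField (SignType.sign α) n (1, x)) := by
  have hc : 0 < |α| * (T - t) := mul_pos (abs_pos.2 hα) (by linarith)
  rw [← normL2_beltramiField _ n hc]
  exact normL2_comp_sub _ (continuous_beltramiField _ n hc) (t • v)

lemma isSolution_concentratingField (v : Space) {α : ℝ} (hα : α ≠ 0) (T : ℝ) (n : ℕ) :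
    IsSolution T (fun _ _ => v) (fun _ _ => α) (concentratingField v α T n 0)
      (concentratingField v α T n) where
  smooth := smoothOn_concentratingField v hα T n
  finite_energy t ht := by
    refine ⟨((smoothOn_concentratingField v hα T n).slice ht).continuous.aestronglyMeasurable, ?_⟩
    have := normL2_concentratingField v hα ht.2 n
    rw [normL2] at this
    rw [this]
    exact ENNReal.mul_lt_top ENNReal.ofReal_lt_top (memLp_beltramiField _ n).eLpNorm_lt_top
  induction_eq := inductionEq_concentratingField v hα T n
  div_free t ht := div_concentratingField v hα ht.2 n
  initial := rfl

lemma exists_amplified_solution (v : Space) {α : ℝ} (hα : α ≠ 0) {T t : ℝ} (C : ℝ) (ht : 0 < t)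
    (htT : t < T) :
    ∃ f B, IsSolution T (fun _ _ => v) (fun _ _ => α) f B ∧
      ENNReal.ofReal C * normL2 f < normL2 (B t) := by
  have hT : 0 < T - t := by linarith
  obtain ⟨n, hn⟩ := pow_unbounded_of_one_lt (C * (T ^ (3 / 2 : ℝ) * (T - t) ^ 4 /
    (T ^ 4 * (T - t) ^ (3 / 2 : ℝ)))) ((one_lt_div hT).2 (by linarith : T - t < T))
  refine ⟨_, _, isSolution_concentratingField v hα T n, ?_⟩
  have hσ : ((SignType.sign α : SignType) : ℝ) ≠ 0 := by
    rcases lt_or_gt_of_ne hα with h | h <;> simp [h]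
  rw [normL2_concentratingField v hα htT, normL2_concentratingField v hα (ht.trans htT),
    ← mul_assoc]
  refine ENNReal.mul_lt_mul_left (normL2_beltramiField_ne_zero hσ n)
    (memLp_beltramiField _ n).eLpNorm_ne_top ?_
  have hα' : 0 < |α| := abs_pos.2 hα
  have hT0 : 0 < T := ht.trans htT
  rw [← ENNReal.ofReal_mul' (by positivity), sub_zero]
  refine (ENNReal.ofReal_lt_ofReal_iff (by positivity)).2 ?_
  have hz (y : ℝ) (hy : 0 < y) : (|α| * y) ^ (-4 - n : ℤ) * (|α| * y) ^ (3 / 2 : ℝ) =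
      (|α| ^ (-4 - n : ℤ) * |α| ^ (3 / 2 : ℝ)) * (y ^ (3 / 2 : ℝ) / (y ^ 4 * y ^ n)) := by
    rw [mul_zpow, Real.mul_rpow hα'.le hy.le,
      show (-4 - n : ℤ) = -((4 + n : ℕ) : ℤ) by push_cast; ring, zpow_neg y, zpow_natCast y, pow_add]
    field_simp
  rw [hz _ hT, hz _ hT0, mul_left_comm]
  refine mul_lt_mul_of_pos_left ?_ (by positivity)
  rw [div_pow] at hn
  have hpos : 0 < T ^ 4 * (T - t) ^ (3 / 2 : ℝ) / ((T - t) ^ 4 * T ^ n * T ^ 4) := by positivity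
  have h3 := mul_lt_mul_of_pos_right hn hpos
  have hTt := hT.ne'
  calc _ = C * (T ^ (3 / 2 : ℝ) * (T - t) ^ 4 / (T ^ 4 * (T - t) ^ (3 / 2 : ℝ))) *
        (T ^ 4 * (T - t) ^ (3 / 2 : ℝ) / ((T - t) ^ 4 * T ^ n * T ^ 4)) := by
        field_simp
    _ < _ := h3
    _ = _ := by field_simp

/-! ### Integral identities -/

/-- The `L²` norm as a real number. -/
def l2 {E : Type} [NormedAddCommGroup E] (f : Space → E) : ℝ := (normL2 f).toReal

lemma l2_nonneg {E : Type} [NormedAddCommGroup E] (f : Space → E) : 0 ≤ l2 f :=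
  ENNReal.toReal_nonneg

section L2

variable {E F : Type} [NormedAddCommGroup E] [NormedAddCommGroup F]

lemma integrable_norm_mul_norm {f : Space → E} {g : Space → F} (hf : MemLp f 2 volume)
    (hg : MemLp g 2 volume) : Integrable (fun x => ‖f x‖ * ‖g x‖) volume :=
  MemLp.integrable_mul (p := 2) (q := 2) hf.norm hg.norm

lemma integral_norm_mul_norm_le {f : Space → E} {g : Space → F} (hf : MemLp f 2 volume)
    (hg : MemLp g 2 volume) : ∫ x, ‖f x‖ * ‖g x‖ ≤ l2 f * l2 g := by
  have h2 : ENNReal.ofReal 2 = 2 := by simp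
  have h := integral_mul_le_Lp_mul_Lq_of_nonneg (μ := (volume : Measure Space))
    (f := fun x => ‖f x‖) (g := fun x => ‖g x‖) Real.HolderConjugate.two_two
    (Filter.Eventually.of_forall fun x => norm_nonneg _)
    (Filter.Eventually.of_forall fun x => norm_nonneg _) (by rw [h2]; exact hf.norm)
    (by rw [h2]; exact hg.norm)
  have key {H : Type} [NormedAddCommGroup H] {u : Space → H} (hu : MemLp u 2 volume) :
      (∫ x, ‖u x‖ ^ (2 : ℝ)) ^ (1 / 2 : ℝ) = l2 u := by
    rw [l2, normL2, hu.eLpNorm_eq_integral_rpow_norm (by simp) (by simp),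
      ENNReal.toReal_ofReal (by positivity)]
    simp
  rwa [key hf, key hg] at h

lemma integral_norm_sq_eq {f : Space → E} (hf : MemLp f 2 volume) :
    ∫ x, ‖f x‖ ^ 2 = l2 f ^ 2 := by
  rw [l2, normL2, hf.eLpNorm_eq_integral_rpow_norm (by simp) (by simp),
    ENNReal.toReal_ofReal (by positivity), ← Real.rpow_natCast, ← Real.rpow_mul (by positivity)]
  simp

lemma l2_add_le {f g : Space → E} (hf : MemLp f 2 volume) (hg : MemLp g 2 volume) :
    l2 (fun x => f x + g x) ≤ l2 f + l2 g := by
  simp only [l2, normL2]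
  rw [← ENNReal.toReal_add hf.eLpNorm_ne_top hg.eLpNorm_ne_top]
  exact ENNReal.toReal_mono (ENNReal.add_ne_top.2 ⟨hf.eLpNorm_ne_top, hg.eLpNorm_ne_top⟩)
    (eLpNorm_add_le hf.1 hg.1 (by norm_num))

lemma l2_mono {f : Space → E} {g : Space → F} (hg : MemLp g 2 volume)
    (h : ∀ x, ‖f x‖ ≤ ‖g x‖) : l2 f ≤ l2 g :=
  ENNReal.toReal_mono hg.eLpNorm_ne_top (eLpNorm_mono h)

lemma l2_const_smul [NormedSpace ℝ E] (c : ℝ) (f : Space → E) :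
    l2 (fun x => c • f x) = |c| * l2 f := by
  rw [l2, normL2, show (fun x => c • f x) = c • f from rfl, eLpNorm_const_smul, ENNReal.toReal_mul]
  simp [l2, normL2]

end L2

lemma integral_mul_fderiv {f g : Space → ℝ} (hf : ContDiff ℝ ∞ f) (hg : ContDiff ℝ ∞ g)
    (hgc : HasCompactSupport g) (e : Space) :
    ∫ x, fderiv ℝ f x e * g x = -∫ x, f x * fderiv ℝ g x e := by
  have hf' : Continuous (fun x => fderiv ℝ f x e) :=
    (hf.continuous_fderiv (by simp)).clm_apply continuous_const
  have hg' : Continuous (fun x => fderiv ℝ g x e) :=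
    (hg.continuous_fderiv (by simp)).clm_apply continuous_const
  have hgc' : HasCompactSupport (fun x => fderiv ℝ g x e) := hgc.fderiv_apply (𝕜 := ℝ) e
  rw [integral_mul_fderiv_eq_neg_fderiv_mul_of_integrable, neg_neg]
  · exact (hf'.mul hg.continuous).integrable_of_hasCompactSupport hgc.mul_left
  · exact (hf.continuous.mul hg').integrable_of_hasCompactSupport hgc'.mul_left
  · exact (hf.continuous.mul hg.continuous).integrable_of_hasCompactSupport hgc.mul_left
  · exact fun x _ => hf.differentiable (by simp) x
  · exact fun x _ => hg.differentiable (by simp) x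

lemma contDiff_comp_apply {F : Space → Space} (hF : ContDiff ℝ ∞ F) (i : Fin 3) :
    ContDiff ℝ ∞ (fun y => F y i) := contDiff_euclidean.1 hF i

lemma hasCompactSupport_apply {F : Space → Space} (hF : HasCompactSupport F) (i : Fin 3) :
    HasCompactSupport (fun y => F y i) :=
  hF.comp_left (g := fun y : Space => y i) rfl

lemma contDiff_pd {F : Space → Space} (hF : ContDiff ℝ ∞ F) (j : Fin 3) :
    ContDiff ℝ ∞ (pd j F) :=
  (hF.fderiv_right (by simp)).clm_apply contDiff_const

lemma contDiff_curl {F : Space → Space} (hF : ContDiff ℝ ∞ F) : ContDiff ℝ ∞ (curl F) := by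
  have h (j i : Fin 3) : ContDiff ℝ ∞ (fun x => pd j F x i) :=
    contDiff_comp_apply (contDiff_pd hF j) i
  refine contDiff_euclidean.2 fun i => ?_
  fin_cases i
  · exact (h 1 2).sub (h 2 1)
  · exact (h 2 0).sub (h 0 2)
  · exact (h 0 1).sub (h 1 0)

lemma hasCompactSupport_curl {F : Space → Space} (hF : HasCompactSupport F) :
    HasCompactSupport (curl F) := by
  refine HasCompactSupport.intro' (K := tsupport F) hF (isClosed_tsupport F) fun x hx => ?_
  have : fderiv ℝ F x = 0 := by
    have := notMem_subset (tsupport_fderiv_subset ℝ (f := F)) hx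
    exact image_eq_zero_of_notMem_tsupport this
  simp only [curl, pd, this]
  ext i; fin_cases i <;> simp

lemma inner_eq_sum (a b : Space) : inner ℝ a b = a 0 * b 0 + a 1 * b 1 + a 2 * b 2 := by
  simp [PiLp.inner_apply, Fin.sum_univ_three, mul_comm]

lemma integral_inner_curl {F G : Space → Space} (hF : ContDiff ℝ ∞ F) (hG : ContDiff ℝ ∞ G)
    (hGc : HasCompactSupport G) :
    ∫ x, inner ℝ (curl F x) (G x) = ∫ x, inner ℝ (F x) (curl G x) := by
  have hFd := hF.differentiable (by simp)
  have hGd := hG.differentiable (by simp)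
  have hpc (j i : Fin 3) : HasCompactSupport (fun x => pd j G x i) :=
    hasCompactSupport_apply (hGc.fderiv_apply (𝕜 := ℝ) _) i
  have i1 (j k i : Fin 3) : Integrable (fun x => pd j F x k * G x i) volume :=
    ((contDiff_comp_apply (contDiff_pd hF j) k).continuous.mul
      (contDiff_comp_apply hG i).continuous).integrable_of_hasCompactSupport
      (hasCompactSupport_apply hGc i).mul_left
  have i2 (j k i : Fin 3) : Integrable (fun x => F x k * pd j G x i) volume :=
    ((contDiff_comp_apply hF k).continuous.mul
      (contDiff_comp_apply (contDiff_pd hG j) i).continuous).integrable_of_hasCompactSupport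
      (hpc j i).mul_left
  have h (j k i : Fin 3) : ∫ x, pd j F x k * G x i = -∫ x, F x k * pd j G x i := by
    have := integral_mul_fderiv (contDiff_comp_apply hF k) (contDiff_comp_apply hG i)
      (hasCompactSupport_apply hGc i) (EuclideanSpace.single j 1)
    simpa only [pd_apply (hFd _), pd_apply (hGd _)] using! this
  have e1 : ∀ x, inner ℝ (curl F x) (G x) =
      ((pd 1 F x 2 * G x 0 - pd 2 F x 1 * G x 0) + (pd 2 F x 0 * G x 1 - pd 0 F x 2 * G x 1)) +
        (pd 0 F x 1 * G x 2 - pd 1 F x 0 * G x 2) := by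
    intro x; rw [inner_eq_sum]; simp [curl]; ring
  have e2 : ∀ x, inner ℝ (F x) (curl G x) =
      ((F x 0 * pd 1 G x 2 - F x 0 * pd 2 G x 1) + (F x 1 * pd 2 G x 0 - F x 1 * pd 0 G x 2)) +
        (F x 2 * pd 0 G x 1 - F x 2 * pd 1 G x 0) := by
    intro x; rw [inner_eq_sum]; simp [curl]; ring
  simp only [e1, e2]
  have split {a b c d e f : Space → ℝ} (ha : Integrable a) (hb : Integrable b)
      (hc : Integrable c) (hd : Integrable d) (he : Integrable e) (hf : Integrable f) :
      ∫ x, ((a x - b x) + (c x - d x)) + (e x - f x) =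
        ((∫ x, a x) - ∫ x, b x) + ((∫ x, c x) - ∫ x, d x) + ((∫ x, e x) - ∫ x, f x) := by
    have hab : Integrable (fun x => a x - b x) := ha.sub hb
    have hcd : Integrable (fun x => c x - d x) := hc.sub hd
    have hef : Integrable (fun x => e x - f x) := he.sub hf
    have habcd : Integrable (fun x => (a x - b x) + (c x - d x)) := hab.add hcd
    rw [integral_add habcd hef, integral_add hab hcd, integral_sub ha hb, integral_sub hc hd,
      integral_sub he hf]
  rw [split (i1 _ _ _) (i1 _ _ _) (i1 _ _ _) (i1 _ _ _) (i1 _ _ _) (i1 _ _ _),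
    split (i2 _ _ _) (i2 _ _ _) (i2 _ _ _) (i2 _ _ _) (i2 _ _ _) (i2 _ _ _)]
  simp only [h]
  ring

lemma fderiv_eq_sum_pd (F : Space → Space) (x a : Space) :
    fderiv ℝ F x a = a 0 • pd 0 F x + a 1 • pd 1 F x + a 2 • pd 2 F x := by
  have h : a = a 0 • EuclideanSpace.single 0 (1 : ℝ) + a 1 • EuclideanSpace.single 1 (1 : ℝ) +
      a 2 • EuclideanSpace.single 2 (1 : ℝ) := by
    ext i; fin_cases i <;> simp
  conv_lhs => rw [h]
  simp [pd]

lemma curl_cross_const {B : Space → Space} {x : Space} (hB : DifferentiableAt ℝ B x) (a : Space) :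
    curl (fun y => cross a (B y)) x = div B x • a - fderiv ℝ B x a := by
  have h1 (j : Fin 3) : pd j (fun y => cross a (B y)) x = cross a (pd j B x) := by
    rw [pd_cross (differentiableAt_const a) hB, pd_const]
    ext i; fin_cases i <;> simp [cross]
  rw [fderiv_eq_sum_pd]
  simp only [curl, h1, div, Fin.sum_univ_three]
  ext i; fin_cases i <;> simp [cross] <;> ring

lemma integral_inner_fderiv {F G : Space → Space} (hF : ContDiff ℝ ∞ F) (hG : ContDiff ℝ ∞ G)
    (hGc : HasCompactSupport G) (a : Space) :
    ∫ x, inner ℝ (fderiv ℝ F x a) (G x) = -∫ x, inner ℝ (F x) (fderiv ℝ G x a) := by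
  have hF' : Continuous (fun x => fderiv ℝ F x a) :=
    (hF.continuous_fderiv (by simp)).clm_apply continuous_const
  have hG' : Continuous (fun x => fderiv ℝ G x a) :=
    (hG.continuous_fderiv (by simp)).clm_apply continuous_const
  have hGc' : HasCompactSupport (fun x => fderiv ℝ G x a) := hGc.fderiv_apply (𝕜 := ℝ) a
  have hc {u w : Space → Space} (hu : Continuous u) (hw : Continuous w)
      (hwc : HasCompactSupport w) : Integrable (fun x => innerSL ℝ (u x) (w x)) volume := by
    refine Continuous.integrable_of_hasCompactSupport (hu.inner hw) ?_
    refine HasCompactSupport.intro' hwc (isClosed_tsupport w) fun x hx => ?_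
    simp [image_eq_zero_of_notMem_tsupport hx]
  have : ∫ x, inner ℝ (F x) (fderiv ℝ G x a) = -∫ x, inner ℝ (fderiv ℝ F x a) (G x) :=
    integral_bilinear_fderiv_right_eq_neg_left_of_integrable (μ := (volume : Measure Space))
    (B := innerSL ℝ) (f := F) (g := G) (v := a) (hc hF' hG.continuous hGc)
    (hc hF.continuous hG' hGc') (hc hF.continuous hG.continuous hGc)
    (fun x _ => hF.differentiable (by simp) x) (fun x _ => hG.differentiable (by simp) x)
  rw [this, neg_neg]

lemma integrable_inner_of_hasCompactSupport {u w : Space → Space} (hu : Continuous u)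
    (hw : Continuous w) (hwc : HasCompactSupport w) :
    Integrable (fun x => inner ℝ (u x) (w x)) volume := by
  refine Continuous.integrable_of_hasCompactSupport (hu.inner hw) ?_
  refine HasCompactSupport.intro' hwc (isClosed_tsupport w) fun x hx => ?_
  simp [image_eq_zero_of_notMem_tsupport hx]

/-! ### Time-dependent pairings -/

lemma continuousOn_pairing {T : ℝ} {B : ℝ → Space → Space} (hB : SmoothOn T B) {G : Space → Space}
    (hG : Continuous G) (hGc : HasCompactSupport G) :
    ContinuousOn (fun t => ∫ x, inner ℝ (B t x) (G x)) (Ico 0 T) := by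
  refine continuousOn_integral_of_compact_support (k := tsupport G) hGc ?_ ?_
  · have h1 : ContinuousOn (fun p : ℝ × Space => B p.1 p.2) (Ico 0 T ×ˢ univ) :=
      ContDiffOn.continuousOn hB
    exact h1.inner (hG.comp continuous_snd).continuousOn
  · intro t x _ hx
    simp [image_eq_zero_of_notMem_tsupport hx]

lemma hasDerivAt_pairing {T : ℝ} {B B' : ℝ → Space → Space} (hB : SmoothOn T B)
    (hB' : ∀ t ∈ Ioo 0 T, ∀ x, HasDerivAt (fun s => B s x) (B' t x) t) {G : Space → Space}
    (hG : Continuous G) (hGc : HasCompactSupport G) {t : ℝ} (ht : t ∈ Ioo 0 T) :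
    HasDerivAt (fun t => ∫ x, inner ℝ (B t x) (G x)) (∫ x, inner ℝ (B' t x) (G x)) t := by
  have hopen : IsOpen (Ioo 0 T ×ˢ (univ : Set Space)) := isOpen_Ioo.prod isOpen_univ
  have hB1 : ContDiffOn ℝ ∞ (fun p : ℝ × Space => B p.1 p.2) (Ioo 0 T ×ˢ univ) :=
    ContDiffOn.mono hB (prod_mono Ioo_subset_Ico_self subset_rfl)
  -- the time derivative is jointly continuous
  have hcont : ContinuousOn (fun p : ℝ × Space => B' p.1 p.2) (Ioo 0 T ×ˢ univ) := by
    have h1 : ContinuousOn (fun p => fderiv ℝ (fun p : ℝ × Space => B p.1 p.2) p (1, 0))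
        (Ioo 0 T ×ˢ univ) :=
      (hB1.continuousOn_fderiv_of_isOpen hopen (by simp)).clm_apply continuousOn_const
    refine h1.congr fun p hp => ?_
    have h2 : HasFDerivAt (fun p : ℝ × Space => B p.1 p.2) _ (p.1, p.2) :=
      ((hB1.contDiffAt (hopen.mem_nhds hp)).differentiableAt (by simp)).hasFDerivAt
    have h3 : HasDerivAt (fun s : ℝ => ((s, p.2) : ℝ × Space)) (1, 0) p.1 :=
      (hasDerivAt_id p.1).prodMk (hasDerivAt_const p.1 p.2)
    have h4 := h2.comp_hasDerivAt p.1 h3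
    exact (hB' p.1 hp.1 p.2).unique h4
  obtain ⟨a, b, hab, hnhds, hsub⟩ : ∃ a b, t ∈ Icc a b ∧ Icc a b ∈ nhds t ∧ Icc a b ⊆ Ioo 0 T := by
    refine ⟨t / 2, (t + T) / 2, ⟨?_, ?_⟩, Icc_mem_nhds ?_ ?_, fun s hs => ⟨?_, ?_⟩⟩ <;>
      first | linarith [ht.1, ht.2] | linarith [ht.1, ht.2, hs.1, hs.2]
  obtain ⟨K, hK⟩ := (isCompact_Icc.prod hGc).exists_bound_of_continuousOn
    (hcont.mono (prod_mono hsub (subset_univ _)) : ContinuousOn _ (Icc a b ×ˢ tsupport G))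
  have hslice (s : ℝ) (hs : s ∈ Ioo 0 T) : Continuous (B s) :=
    (hB.slice ⟨hs.1.le, hs.2⟩).continuous
  have hslice' (s : ℝ) (hs : s ∈ Ioo 0 T) : Continuous (B' s) :=
    hcont.comp_continuous (f := fun x => (s, x)) (by fun_prop) (fun x => ⟨hs, mem_univ x⟩)
  refine (hasDerivAt_integral_of_dominated_loc_of_deriv_le (bound := fun x => K * ‖G x‖)
    (F' := fun s x => inner ℝ (B' s x) (G x)) hnhds ?_ ?_ ?_ ?_ ?_ ?_).2
  · filter_upwards [hnhds] with s hs
    exact ((hslice s (hsub hs)).inner hG).aestronglyMeasurable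
  · exact integrable_inner_of_hasCompactSupport (hslice t ht) hG hGc
  · exact ((hslice' t ht).inner hG).aestronglyMeasurable
  · refine Filter.Eventually.of_forall fun x s hs => ?_
    by_cases hx : x ∈ tsupport G
    · exact (norm_inner_le_norm _ _).trans
        (mul_le_mul_of_nonneg_right (hK (s, x) ⟨hs, hx⟩) (norm_nonneg _))
    · simp [image_eq_zero_of_notMem_tsupport hx]
  · exact (hG.norm.integrable_of_hasCompactSupport hGc.norm).const_mul K
  · refine Filter.Eventually.of_forall fun x s hs => ?_
    simpa using! (hB' s (hsub hs) x).inner ℝ (hasDerivAt_const s (G x))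

/-! ### Beltrami waves -/

lemma exists_unit_orthogonal (a : Space) : ∃ u : Space, ‖u‖ = 1 ∧ inner ℝ u a = 0 := by
  have h : Module.finrank ℝ ℝ < Module.finrank ℝ Space := by simp
  obtain ⟨u, hu, hu0⟩ := Submodule.exists_mem_ne_zero_of_ne_bot
    (LinearMap.ker_ne_bot_of_finrank_lt (f := (innerSL ℝ a : Space →ₗ[ℝ] ℝ)) h)
  refine ⟨‖u‖⁻¹ • u, by simp [norm_smul, hu0], ?_⟩
  rw [inner_smul_left, real_inner_comm]
  have : inner ℝ a u = 0 := hu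
  simp [this]

lemma norm_cross_le (a b : Space) : ‖cross a b‖ ≤ ‖a‖ * ‖b‖ := by
  refine le_of_sq_le_sq ?_ (by positivity)
  rw [mul_pow, ← real_inner_self_eq_norm_sq, ← real_inner_self_eq_norm_sq,
    ← real_inner_self_eq_norm_sq]
  simp only [inner_eq_sum]
  simp [cross]
  nlinarith [sq_nonneg (a 0 * b 0 + a 1 * b 1 + a 2 * b 2)]

/-- For every `v` there is a periodic field of constant length, constant along `v`, that is an
eigenfield of the curl with the eigenvalue `±μ`. -/
lemma exists_beltrami_wave (v : Space) {σ : ℝ} (hσ : σ ^ 2 = 1) (μ : ℝ) :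
    ∃ ψ : Space → Space, ContDiff ℝ ∞ ψ ∧ (∀ x, ‖ψ x‖ = 1) ∧
      (∀ x, curl ψ x = (σ * μ) • ψ x) ∧ ∀ x, fderiv ℝ ψ x v = 0 := by
  obtain ⟨k, hk, hkv⟩ := exists_unit_orthogonal v
  obtain ⟨p, hp, hpk⟩ := exists_unit_orthogonal k
  have hk2 : k 0 * k 0 + k 1 * k 1 + k 2 * k 2 = 1 := by
    rw [← inner_eq_sum, real_inner_self_eq_norm_sq, hk, one_pow]
  have hp2 : p 0 * p 0 + p 1 * p 1 + p 2 * p 2 = 1 := by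
    rw [← inner_eq_sum, real_inner_self_eq_norm_sq, hp, one_pow]
  have hpk' : p 0 * k 0 + p 1 * k 1 + p 2 * k 2 = 0 := by rw [← inner_eq_sum, hpk]
  set q : Space := cross k p with hq
  have hqq : q 0 * q 0 + q 1 * q 1 + q 2 * q 2 = 1 := by
    simp [hq, cross]
    linear_combination (p 0 * p 0 + p 1 * p 1 + p 2 * p 2) * hk2 + hp2 -
      (p 0 * k 0 + p 1 * k 1 + p 2 * k 2) * hpk'
  have hpq : p 0 * q 0 + p 1 * q 1 + p 2 * q 2 = 0 := by simp [hq, cross]; ring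
  have hkq : cross k q = -p := by
    ext i
    fin_cases i <;> simp [hq, cross]
    · linear_combination k 0 * hpk' - p 0 * hk2
    · linear_combination k 1 * hpk' - p 1 * hk2
    · linear_combination k 2 * hpk' - p 2 * hk2
  let θ : Space → ℝ := fun x => μ * inner ℝ k x
  have hθ (x : Space) : HasFDerivAt θ (μ • innerSL ℝ k) x :=
    (innerSL ℝ k : Space →L[ℝ] ℝ).hasFDerivAt.const_mul μ
  have hd (x a : Space) : fderiv ℝ (fun x => Real.cos (θ x) • p - (σ * Real.sin (θ x)) • q) x a =
      (μ * inner ℝ k a) • (-Real.sin (θ x) • p - (σ * Real.cos (θ x)) • q) := by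
    have h := ((hθ x).cos.smul_const p).sub (((hθ x).sin.const_mul σ).smul_const q)
    have h' : fderiv ℝ (fun x => Real.cos (θ x) • p - (σ * Real.sin (θ x)) • q) x = _ := h.fderiv
    rw [h']
    ext i
    simp
    ring
  refine ⟨fun x => Real.cos (θ x) • p - (σ * Real.sin (θ x)) • q, ?_, fun x => ?_, fun x => ?_,
    fun x => ?_⟩
  · have : ContDiff ℝ ∞ θ := contDiff_const.mul (contDiff_const.inner ℝ contDiff_id)
    exact (this.cos.smul contDiff_const).sub ((contDiff_const.mul this.sin).smul contDiff_const)
  · have : ‖Real.cos (θ x) • p - (σ * Real.sin (θ x)) • q‖ ^ 2 = 1 := by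
      rw [← real_inner_self_eq_norm_sq, inner_eq_sum]
      simp only [PiLp.sub_apply, PiLp.smul_apply, smul_eq_mul]
      linear_combination Real.cos (θ x) ^ 2 * hp2 + σ ^ 2 * Real.sin (θ x) ^ 2 * hqq -
        2 * σ * Real.cos (θ x) * Real.sin (θ x) * hpq + Real.sin (θ x) ^ 2 * hσ +
        Real.sin_sq_add_cos_sq (θ x)
    exact (pow_eq_one_iff_of_nonneg (norm_nonneg _) two_ne_zero).1 this
  · have hpd (j : Fin 3) :
        pd j (fun x => Real.cos (θ x) • p - (σ * Real.sin (θ x)) • q) x =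
        (μ * k j) • (-Real.sin (θ x) • p - (σ * Real.cos (θ x)) • q) := by
      rw [pd, hd]
      simp [EuclideanSpace.inner_single_right]
    have h1 : curl (fun x => Real.cos (θ x) • p - (σ * Real.sin (θ x)) • q) x =
        (μ * -Real.sin (θ x)) • cross k p - (μ * σ * Real.cos (θ x)) • cross k q := by
      simp only [curl, hpd]
      ext i; fin_cases i <;> simp [cross] <;> ring
    rw [h1, hkq, ← hq]
    ext i
    simp only [PiLp.sub_apply, PiLp.smul_apply, smul_eq_mul, PiLp.neg_apply]
    linear_combination μ * Real.sin (θ x) * q i * hσ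
  · rw [hd, hkv, mul_zero, zero_smul]

/-! ### Localized Beltrami waves as test fields -/

lemma norm_gradient (χ : Space → ℝ) (x : Space) : ‖gradient χ x‖ = ‖fderiv ℝ χ x‖ := by
  simp [gradient]

lemma gradient_apply (χ : Space → ℝ) (x : Space) (j : Fin 3) :
    gradient χ x j = fderiv ℝ χ x (EuclideanSpace.single j 1) := by
  have h : inner ℝ (gradient χ x) (EuclideanSpace.single j (1 : ℝ)) =
      fderiv ℝ χ x (EuclideanSpace.single j 1) := by
    rw [gradient, InnerProductSpace.toDual_symm_apply]
  rw [← h, EuclideanSpace.inner_single_right]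
  simp

lemma curl_smul {χ : Space → ℝ} {ψ : Space → Space} {x : Space} (hχ : DifferentiableAt ℝ χ x)
    (hψ : DifferentiableAt ℝ ψ x) :
    curl (fun y => χ y • ψ y) x = χ x • curl ψ x + cross (gradient χ x) (ψ x) := by
  simp only [curl, pd_smul hχ hψ]
  ext i; fin_cases i <;> simp [cross, gradient_apply] <;> ring

lemma curl_add {F G : Space → Space} {x : Space} (hF : DifferentiableAt ℝ F x)
    (hG : DifferentiableAt ℝ G x) : curl (fun y => F y + G y) x = curl F x + curl G x := by
  simp only [curl, pd_add hF hG]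
  ext i; fin_cases i <;> simp <;> ring

lemma contDiff_cross_comp {F G : Space → Space} (hF : ContDiff ℝ ∞ F) (hG : ContDiff ℝ ∞ G) :
    ContDiff ℝ ∞ (fun y => cross (F y) (G y)) :=
  contDiff_cross.comp (hF.prodMk hG)

/-- The dynamo operator, with the velocity `v₀` and the coefficient `α₀` split off, applied to a
divergence-free field. -/
lemma dynamoOp_eq_curl_sub {v B : Space → Space} {α : Space → ℝ} (hv : ContDiff ℝ ∞ v)
    (hα : ContDiff ℝ ∞ α) (hB : ContDiff ℝ ∞ B) (hdiv : ∀ x, div B x = 0) (v₀ : Space) (α₀ : ℝ)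
    (x : Space) :
    dynamoOp v α B x =
      curl (fun y => (cross (v y - v₀) (B y) + (α y - α₀) • B y) + α₀ • B y) x -
        fderiv ℝ B x v₀ := by
  have hd {F : Space → Space} (hF : ContDiff ℝ ∞ F) : DifferentiableAt ℝ F x :=
    hF.differentiable (by simp) x
  have hs {a : Space → ℝ} (ha : ContDiff ℝ ∞ a) : ContDiff ℝ ∞ (fun y => a y • B y) := ha.smul hB
  have h0 : curl (fun y => cross v₀ (B y)) x = -fderiv ℝ B x v₀ := by
    rw [curl_cross_const (hd hB), hdiv, zero_smul, zero_sub]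
  rw [dynamoOp, ← curl_add (hd (contDiff_cross_comp hv hB)) (hd (hs hα)), sub_eq_add_neg,
    ← h0, ← curl_add (hd (((contDiff_cross_comp (hv.sub contDiff_const) hB).add
      (hs (hα.sub contDiff_const))).add (hs contDiff_const)))
      (hd (contDiff_cross_comp contDiff_const hB))]
  congr 1
  funext y
  ext i; fin_cases i <;> simp [cross] <;> ring

/-- A smooth cutoff function bounded by one. -/
structure IsCutoff (χ : Space → ℝ) : Prop where
  smooth : ContDiff ℝ ∞ χ
  compact : HasCompactSupport χ
  abs_le_one : ∀ x, |χ x| ≤ 1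

/-- The defining properties of the fields of `exists_beltrami_wave`. -/
structure IsBeltrami (v₀ : Space) (σ μ : ℝ) (ψ : Space → Space) : Prop where
  smooth : ContDiff ℝ ∞ ψ
  norm_eq_one : ∀ x, ‖ψ x‖ = 1
  curl_eq : ∀ x, curl ψ x = (σ * μ) • ψ x
  fderiv_eq_zero : ∀ x, fderiv ℝ ψ x v₀ = 0

section Packet

variable {v₀ : Space} {σ μ : ℝ} {ψ : Space → Space} {χ : Space → ℝ}

lemma IsCutoff.contDiff_smul (hχ : IsCutoff χ) (hψ : IsBeltrami v₀ σ μ ψ) :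
    ContDiff ℝ ∞ (fun x => χ x • ψ x) := hχ.smooth.smul hψ.smooth

lemma IsCutoff.hasCompactSupport_smul (hχ : IsCutoff χ) (ψ : Space → Space) :
    HasCompactSupport (fun x => χ x • ψ x) := hχ.compact.smul_right (f' := ψ)

lemma IsCutoff.memLp (hχ : IsCutoff χ) : MemLp χ 2 volume :=
  hχ.smooth.continuous.memLp_of_hasCompactSupport hχ.compact

lemma IsCutoff.memLp_fderiv (hχ : IsCutoff χ) : MemLp (fderiv ℝ χ) 2 volume :=
  (hχ.smooth.continuous_fderiv (by simp)).memLp_of_hasCompactSupport (hχ.compact.fderiv (𝕜 := ℝ))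

lemma IsBeltrami.curl_packet (hψ : IsBeltrami v₀ σ μ ψ) (hχ : IsCutoff χ) (x : Space) :
    curl (fun y => χ y • ψ y) x = (σ * μ) • (χ x • ψ x) + cross (gradient χ x) (ψ x) := by
  rw [curl_smul (hχ.smooth.differentiable (by simp) x) (hψ.smooth.differentiable (by simp) x),
    hψ.curl_eq, smul_comm]

lemma IsBeltrami.norm_cross_gradient_le (hψ : IsBeltrami v₀ σ μ ψ) (x : Space) :
    ‖cross (gradient χ x) (ψ x)‖ ≤ ‖fderiv ℝ χ x‖ := by
  have := norm_cross_le (gradient χ x) (ψ x)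
  rwa [hψ.norm_eq_one, mul_one, norm_gradient] at this

lemma IsBeltrami.fderiv_packet (hψ : IsBeltrami v₀ σ μ ψ) (hχ : IsCutoff χ) (x : Space) :
    ‖fderiv ℝ (fun y => χ y • ψ y) x v₀‖ ≤ ‖v₀‖ * ‖fderiv ℝ χ x‖ := by
  rw [fderiv_fun_smul (hχ.smooth.differentiable (by simp) x)
    (hψ.smooth.differentiable (by simp) x)]
  simp only [add_apply, smul_apply, ContinuousLinearMap.smulRight_apply, hψ.fderiv_eq_zero,
    smul_zero, zero_add, norm_smul, hψ.norm_eq_one, mul_one]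
  rw [mul_comm]
  exact (fderiv ℝ χ x).le_opNorm v₀

/-- Tested with a localized Beltrami wave, the dynamo operator acts as multiplication by
`|α₀| μ`, up to errors from the cutoff (of order one), from the oscillation of the coefficients
(of order `η μ`), and from the velocity perturbation `v - v'` (quadratic in the solution). -/
lemma abs_integral_dynamoOp_sub_le {v v' B : Space → Space} {α : Space → ℝ} {α₀ η a L : ℝ}
    (hv : ContDiff ℝ ∞ v) (hα : ContDiff ℝ ∞ α) (hB : ContDiff ℝ ∞ B)
    (hdiv : ∀ x, div B x = 0) (hχ : IsCutoff χ) (hψ : IsBeltrami v₀ σ μ ψ)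
    (hσ : σ ^ 2 = 1) (hσα : α₀ * σ = |α₀|) (hμ : 0 < μ) (hη : 0 ≤ η) (ha : 0 ≤ a)
    (hL : ∀ x, ‖fderiv ℝ χ x‖ ≤ L)
    (hv' : ∀ x ∈ tsupport χ, ‖v' x - v₀‖ ≤ η) (hα' : ∀ x ∈ tsupport χ, |α x - α₀| ≤ η)
    (hBm : MemLp B 2 volume) (hBa : l2 B ≤ a)
    (hvm : MemLp (fun x => v x - v' x) 2 volume) (hva : l2 (fun x => v x - v' x) ≤ a) :
    |(∫ x, inner ℝ (dynamoOp v α B x) (χ x • ψ x)) -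
        |α₀| * μ * ∫ x, inner ℝ (B x) (χ x • ψ x)| ≤
      a * ((|α₀| + ‖v₀‖ + 2 * η) * l2 (fderiv ℝ χ) + 2 * η * μ * l2 χ) + (μ + L) * (a * a) := by
  have hG := hχ.contDiff_smul hψ
  have hGc := hχ.hasCompactSupport_smul ψ
  have hL0 : 0 ≤ L := (norm_nonneg _).trans (hL 0)
  set G : Space → Space := fun x => χ x • ψ x with hGdef
  set W : Space → Space := fun y => cross (v y - v₀) (B y) + (α y - α₀) • B y with hW
  have hWs : ContDiff ℝ ∞ W := (contDiff_cross_comp (hv.sub contDiff_const) hB).add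
    ((hα.sub contDiff_const).smul hB)
  have hZs : ContDiff ℝ ∞ (fun y => W y + α₀ • B y) := hWs.add (hB.const_smul α₀)
  have hB' : Continuous (fun x => fderiv ℝ B x v₀) :=
    (hB.continuous_fderiv (by simp)).clm_apply continuous_const
  have hG' : Continuous (fun x => fderiv ℝ G x v₀) :=
    (hG.continuous_fderiv (by simp)).clm_apply continuous_const
  have hGc' : HasCompactSupport (fun x => fderiv ℝ G x v₀) := hGc.fderiv_apply (𝕜 := ℝ) v₀
  have e1 : ∫ x, inner ℝ (dynamoOp v α B x) (G x) =
      (∫ x, inner ℝ (W x + α₀ • B x) (curl G x)) + ∫ x, inner ℝ (B x) (fderiv ℝ G x v₀) := by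
    simp only [dynamoOp_eq_curl_sub hv hα hB hdiv v₀ α₀, inner_sub_left]
    rw [integral_sub (integrable_inner_of_hasCompactSupport (contDiff_curl hZs).continuous
      hG.continuous hGc) (integrable_inner_of_hasCompactSupport hB' hG.continuous hGc),
      integral_inner_curl hZs hG hGc, integral_inner_fderiv hB hG hGc, sub_neg_eq_add]
  have j1 := integrable_inner_of_hasCompactSupport hZs.continuous (contDiff_curl hG).continuous
    (hasCompactSupport_curl hGc)
  have j2 := integrable_inner_of_hasCompactSupport hB.continuous hG' hGc'
  have j12 : Integrable (fun x => inner ℝ (W x + α₀ • B x) (curl G x) +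
    inner ℝ (B x) (fderiv ℝ G x v₀)) := j1.add j2
  have j3 := (integrable_inner_of_hasCompactSupport hB.continuous hG.continuous hGc).const_mul
    (|α₀| * μ)
  rw [e1, ← integral_add j1 j2, ← integral_const_mul, ← integral_sub j12 j3]
  have b1 := (integrable_norm_mul_norm hBm hχ.memLp_fderiv).const_mul (|α₀| + ‖v₀‖ + 2 * η)
  have b2 := (integrable_norm_mul_norm hBm hχ.memLp).const_mul (2 * η * μ)
  have b3 := (integrable_norm_mul_norm hBm hvm).const_mul (μ + L)
  have b12 : Integrable (fun x => (|α₀| + ‖v₀‖ + 2 * η) * (‖B x‖ * ‖fderiv ℝ χ x‖) +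
    2 * η * μ * (‖B x‖ * ‖χ x‖)) := b1.add b2
  have b123 : Integrable (fun x => ((|α₀| + ‖v₀‖ + 2 * η) * (‖B x‖ * ‖fderiv ℝ χ x‖) +
    2 * η * μ * (‖B x‖ * ‖χ x‖)) + (μ + L) * (‖B x‖ * ‖v x - v' x‖)) := b12.add b3
  have hσ1 : |σ| = 1 := by
    have : |σ| ^ 2 = 1 := by rw [sq_abs, hσ]
    nlinarith [abs_nonneg σ]
  rw [← Real.norm_eq_abs]
  refine (norm_integral_le_of_norm_le b123 (Filter.Eventually.of_forall fun x => ?_)).trans ?_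
  · have hR : ‖cross (gradient χ x) (ψ x)‖ ≤ ‖fderiv ℝ χ x‖ := hψ.norm_cross_gradient_le x
    have hV : ‖fderiv ℝ G x v₀‖ ≤ ‖v₀‖ * ‖fderiv ℝ χ x‖ := hψ.fderiv_packet hχ x
    have hcG : curl G x = (σ * μ) • G x + cross (gradient χ x) (ψ x) := hψ.curl_packet hχ x
    set R := cross (gradient χ x) (ψ x)
    have hGx : ‖G x‖ = |χ x| := by simp [hGdef, norm_smul, hψ.norm_eq_one]
    have hcGn : ‖curl G x‖ ≤ μ * |χ x| + ‖fderiv ℝ χ x‖ := by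
      rw [hcG]
      refine (norm_add_le _ _).trans (add_le_add ?_ hR)
      rw [norm_smul, norm_mul, Real.norm_eq_abs, hσ1, Real.norm_of_nonneg hμ.le, one_mul, hGx]
    have e2 : inner ℝ (W x + α₀ • B x) (curl G x) + inner ℝ (B x) (fderiv ℝ G x v₀) -
        |α₀| * μ * inner ℝ (B x) (G x) =
        inner ℝ (W x) (curl G x) + (α₀ * inner ℝ (B x) R + inner ℝ (B x) (fderiv ℝ G x v₀)) := by
      rw [inner_add_left, inner_smul_left]
      conv_lhs => rw [hcG, inner_add_right (B x), inner_smul_right (B x), ← hcG]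
      simp only [conj_trivial]
      rw [← hσα]
      ring
    have hWx : ‖W x‖ * ‖curl G x‖ ≤
        (‖v x - v' x‖ + 2 * η) * ‖B x‖ * (μ * |χ x| + ‖fderiv ℝ χ x‖) := by
      by_cases hx : x ∈ tsupport χ
      · refine mul_le_mul ?_ hcGn (norm_nonneg _) (by positivity)
        have h1 : ‖v x - v₀‖ ≤ ‖v x - v' x‖ + η :=
          (norm_sub_le_norm_sub_add_norm_sub _ (v' x) _).trans (by gcongr; exact hv' x hx)
        calc ‖W x‖ ≤ ‖v x - v₀‖ * ‖B x‖ + |α x - α₀| * ‖B x‖ := by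
              refine (norm_add_le _ _).trans (add_le_add (norm_cross_le _ _) ?_)
              rw [norm_smul, Real.norm_eq_abs]
          _ ≤ (‖v x - v' x‖ + η) * ‖B x‖ + η * ‖B x‖ := by gcongr; exact hα' x hx
          _ = _ := by ring
      · have h1 : χ x = 0 := image_eq_zero_of_notMem_tsupport hx
        have h2 : fderiv ℝ χ x = 0 := image_eq_zero_of_notMem_tsupport
          (notMem_subset (tsupport_fderiv_subset ℝ (f := χ)) hx)
        have h3 : ‖curl G x‖ ≤ 0 := by simpa [h1, h2] using! hcGn
        rw [h1, h2, le_antisymm h3 (norm_nonneg _)]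
        simp
    have hLx : μ * |χ x| + ‖fderiv ℝ χ x‖ ≤ μ + L :=
      add_le_add (mul_le_of_le_one_right hμ.le (hχ.abs_le_one x)) (hL x)
    have hprod : ‖v x - v' x‖ * ‖B x‖ * (μ * |χ x| + ‖fderiv ℝ χ x‖) ≤
        ‖v x - v' x‖ * ‖B x‖ * (μ + L) := by gcongr
    rw [e2]
    calc ‖inner ℝ (W x) (curl G x) + (α₀ * inner ℝ (B x) R + inner ℝ (B x) (fderiv ℝ G x v₀))‖
        ≤ ‖W x‖ * ‖curl G x‖ + (|α₀| * (‖B x‖ * ‖R‖) + ‖B x‖ * ‖fderiv ℝ G x v₀‖) := by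
          refine (norm_add_le _ _).trans (add_le_add (norm_inner_le_norm _ _)
            ((norm_add_le _ _).trans (add_le_add ?_ (norm_inner_le_norm _ _))))
          rw [norm_mul, Real.norm_eq_abs]
          gcongr
          exact norm_inner_le_norm _ _
      _ ≤ (‖v x - v' x‖ + 2 * η) * ‖B x‖ * (μ * |χ x| + ‖fderiv ℝ χ x‖) +
          (|α₀| * (‖B x‖ * ‖fderiv ℝ χ x‖) + ‖B x‖ * (‖v₀‖ * ‖fderiv ℝ χ x‖)) := by gcongr
      _ ≤ _ := by
          rw [Real.norm_eq_abs (χ x)]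
          linarith
  · rw [integral_add b12 b3, integral_add b1 b2, integral_const_mul, integral_const_mul,
      integral_const_mul]
    have c1 : ∫ x, ‖B x‖ * ‖fderiv ℝ χ x‖ ≤ a * l2 (fderiv ℝ χ) :=
      (integral_norm_mul_norm_le hBm hχ.memLp_fderiv).trans
        (mul_le_mul_of_nonneg_right hBa (l2_nonneg _))
    have c2 : ∫ x, ‖B x‖ * ‖χ x‖ ≤ a * l2 χ :=
      (integral_norm_mul_norm_le hBm hχ.memLp).trans (mul_le_mul_of_nonneg_right hBa (l2_nonneg _))
    have c3 : ∫ x, ‖B x‖ * ‖v x - v' x‖ ≤ a * a :=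
      (integral_norm_mul_norm_le hBm hvm).trans (mul_le_mul hBa hva (l2_nonneg _) ha)
    calc _ ≤ (|α₀| + ‖v₀‖ + 2 * η) * (a * l2 (fderiv ℝ χ)) + 2 * η * μ * (a * l2 χ) +
          (μ + L) * (a * a) := by gcongr
      _ = _ := by ring

end Packet

/-! ### Growth of the pairing with a localized Beltrami wave -/

lemma div_curl {G : Space → Space} (hG : ContDiff ℝ ∞ G) (x : Space) : div (curl G) x = 0 := by
  have hd (j i : Fin 3) : DifferentiableAt ℝ (fun y => pd j G y i) x :=
    (contDiff_comp_apply (contDiff_pd hG j) i).differentiable (by simp) x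
  have hdd : DifferentiableAt ℝ (fderiv ℝ G) x :=
    ((hG.fderiv_right (m := ∞) (by simp)).differentiable (by simp)) x
  have hsnd (j k : Fin 3) : pd j (pd k G) x = pd k (pd j G) x := by
    have key (a b : Fin 3) : pd a (pd b G) x = fderiv ℝ (fderiv ℝ G) x
        (EuclideanSpace.single a 1) (EuclideanSpace.single b 1) := by
      change fderiv ℝ (fun q => fderiv ℝ G q (EuclideanSpace.single b 1)) x _ = _
      rw [fderiv_clm_apply hdd (differentiableAt_const _)]
      simp
    rw [key, key]
    refine (hG.contDiffAt.isSymmSndFDerivAt ?_) _ _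
    rw [minSmoothness_of_isRCLikeNormedField]
    exact WithTop.coe_le_coe.2 le_top
  have hc (i : Fin 3) : pd i (curl G) x i =
      fderiv ℝ (fun y => curl G y i) x (EuclideanSpace.single i 1) :=
    pd_apply ((contDiff_curl hG).differentiable (by simp) x) i i
  have hp (j k i : Fin 3) : fderiv ℝ (fun y => pd k G y i) x (EuclideanSpace.single j 1) =
      pd j (pd k G) x i :=
    (pd_apply ((contDiff_pd hG k).differentiable (by simp) x) j i).symm
  have e0 : (fun y => curl G y 0) = fun y => pd 1 G y 2 - pd 2 G y 1 := by
    funext y; simp [curl]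
  have e1 : (fun y => curl G y 1) = fun y => pd 2 G y 0 - pd 0 G y 2 := by
    funext y; simp [curl]
  have e2 : (fun y => curl G y 2) = fun y => pd 0 G y 1 - pd 1 G y 0 := by
    funext y; simp [curl]
  rw [div, Fin.sum_univ_three, hc, hc, hc, e0, e1, e2, fderiv_fun_sub (hd _ _) (hd _ _),
    fderiv_fun_sub (hd _ _) (hd _ _), fderiv_fun_sub (hd _ _) (hd _ _)]
  simp only [sub_apply, hp]
  rw [hsnd 1 0, hsnd 2 0, hsnd 2 1]
  ring

lemma div_const_smul {F : Space → Space} {x : Space} (hF : DifferentiableAt ℝ F x) (c : ℝ) :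
    div (fun y => c • F y) x = c * div F x := by
  have (j : Fin 3) : pd j (fun y => c • F y) x = c • pd j F x := by
    rw [pd_smul (differentiableAt_const c) hF]
    simp
  simp [div, this, Finset.mul_sum]

lemma IsMagneticDatum.const_smul {f : Space → Space} (hf : IsMagneticDatum f) (c : ℝ) :
    IsMagneticDatum (fun x => c • f x) where
  smooth := hf.smooth.const_smul c
  compact := hf.compact.smul_left (f := fun _ => c)
  div_free x := by
    rw [div_const_smul (hf.smooth.differentiable (by simp) x), hf.div_free, mul_zero]

section Packet

variable {v₀ : Space} {σ μ : ℝ} {ψ : Space → Space} {χ : Space → ℝ}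

/-- The integrated form of `abs_integral_dynamoOp_sub_le`: the pairing of a solution with a
localized Beltrami wave grows like `e^{|α₀| μ t}`, so a bound on the solution at the time `t₁`
makes the pairing small initially. -/
lemma pairing_zero_le {T t₁ : ℝ} (ht₁ : 0 < t₁) (ht₁T : t₁ < T) {v v' B : ℝ → Space → Space}
    {α : ℝ → Space → ℝ} {α₀ η a L : ℝ} (hv : SmoothOn T v) (hα : SmoothOn T α)
    (hB : SmoothOn T B) (heq : InductionEq (Ioo 0 T) v α B)
    (hdiv : ∀ t ∈ Ico 0 T, ∀ x, div (B t) x = 0) (hχ : IsCutoff χ) (hψ : IsBeltrami v₀ σ μ ψ)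
    (hα₀ : α₀ ≠ 0) (hσ : σ ^ 2 = 1) (hσα : α₀ * σ = |α₀|) (hμ : 0 < μ) (hη : 0 ≤ η) (ha : 0 ≤ a)
    (hL : ∀ x, ‖fderiv ℝ χ x‖ ≤ L)
    (hv' : ∀ t ∈ Icc 0 t₁, ∀ x ∈ tsupport χ, ‖v' t x - v₀‖ ≤ η)
    (hα' : ∀ t ∈ Icc 0 t₁, ∀ x ∈ tsupport χ, |α t x - α₀| ≤ η)
    (hBm : ∀ t ∈ Ico 0 T, MemLp (B t) 2 volume ∧ l2 (B t) ≤ a)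
    (hvm : ∀ t ∈ Ico 0 T, MemLp (fun x => v t x - v' t x) 2 volume ∧
      l2 (fun x => v t x - v' t x) ≤ a) :
    ∫ x, inner ℝ (B 0 x) (χ x • ψ x) ≤
      Real.exp (-(|α₀| * μ * t₁)) * (a * l2 χ) +
      (a * ((|α₀| + ‖v₀‖ + 2 * η) * l2 (fderiv ℝ χ) + 2 * η * μ * l2 χ) + (μ + L) * (a * a)) /
        (|α₀| * μ) := by
  set E := a * ((|α₀| + ‖v₀‖ + 2 * η) * l2 (fderiv ℝ χ) + 2 * η * μ * l2 χ) + (μ + L) * (a * a)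
    with hE
  set I : ℝ → ℝ := fun t => ∫ x, inner ℝ (B t x) (χ x • ψ x) with hI
  set lam := |α₀| * μ with hlam
  have hlam0 : 0 < lam := mul_pos (abs_pos.2 hα₀) hμ
  have hE0 : 0 ≤ E := by
    have := (norm_nonneg _).trans (hL 0)
    have := l2_nonneg χ
    have := l2_nonneg (fderiv ℝ χ)
    positivity
  have hGs := hχ.contDiff_smul hψ
  have hGc := hχ.hasCompactSupport_smul ψ
  have hIc : ContinuousOn I (Icc 0 t₁) :=
    (continuousOn_pairing hB hGs.continuous hGc).mono fun t ht => ⟨ht.1, ht.2.trans_lt ht₁T⟩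
  have hexp (t : ℝ) :
      HasDerivAt (fun s => Real.exp (-(lam * s))) (-lam * Real.exp (-(lam * t))) t := by
    have := (((hasDerivAt_id t).const_mul lam).neg).exp
    refine this.congr_deriv ?_
    simp [mul_comm]
  -- the function `e^{-λ t} (I(t) - E / λ)` is nondecreasing
  have hder : ∀ t ∈ Ioo 0 t₁, ∃ d, 0 ≤ d ∧
      HasDerivAt (fun s => Real.exp (-(lam * s)) * (I s - E / lam)) d t := by
    intro t ht
    have htT : t ∈ Ioo 0 T := ⟨ht.1, ht.2.trans ht₁T⟩
    have htT' : t ∈ Ico 0 T := ⟨ht.1.le, htT.2⟩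
    have ht' : t ∈ Icc 0 t₁ := ⟨ht.1.le, ht.2.le⟩
    have h1 := hasDerivAt_pairing hB heq hGs.continuous hGc htT
    have h2 := abs_integral_dynamoOp_sub_le (hv.slice htT') (hα.slice htT') (hB.slice htT')
      (hdiv t htT') hχ hψ hσ hσα hμ hη ha hL (hv' t ht') (hα' t ht') (hBm t htT').1 (hBm t htT').2
      (hvm t htT').1 (hvm t htT').2
    have h3 := (abs_le.1 h2).1
    refine ⟨_, ?_, (hexp t).mul (h1.sub_const (E / lam))⟩
    have h4 : -lam * Real.exp (-(lam * t)) * (I t - E / lam) + Real.exp (-(lam * t)) *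
        (∫ x, inner ℝ (dynamoOp (v t) (α t) (B t) x) (χ x • ψ x)) = Real.exp (-(lam * t)) *
        ((∫ x, inner ℝ (dynamoOp (v t) (α t) (B t) x) (χ x • ψ x)) - lam * I t + E) := by
      field_simp
      ring
    refine le_of_le_of_eq ?_ h4.symm
    refine mul_nonneg (Real.exp_pos _).le ?_
    linarith
  have hmono : MonotoneOn (fun s => Real.exp (-(lam * s)) * (I s - E / lam)) (Icc 0 t₁) := by
    refine monotoneOn_of_deriv_nonneg (convex_Icc 0 t₁) ?_ ?_ ?_
    · exact (Continuous.continuousOn (by fun_prop)).mul (hIc.sub continuousOn_const)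
    · intro t ht
      rw [interior_Icc] at ht
      obtain ⟨d, -, hd⟩ := hder t ht
      exact hd.differentiableAt.differentiableWithinAt
    · intro t ht
      rw [interior_Icc] at ht
      obtain ⟨d, hd0, hd⟩ := hder t ht
      rwa [hd.deriv]
  have h5 := hmono (left_mem_Icc.2 ht₁.le) (right_mem_Icc.2 ht₁.le) ht₁.le
  simp only [mul_zero, neg_zero, Real.exp_zero, one_mul] at h5
  have h6 : I t₁ ≤ a * l2 χ := by
    have ht' : t₁ ∈ Ico 0 T := ⟨ht₁.le, ht₁T⟩
    calc I t₁ ≤ ∫ x, ‖B t₁ x‖ * ‖χ x‖ := by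
          refine integral_mono (integrable_inner_of_hasCompactSupport
            (hB.slice ht').continuous hGs.continuous hGc)
            (integrable_norm_mul_norm (hBm t₁ ht').1 hχ.memLp) fun x => ?_
          refine (real_inner_le_norm _ _).trans (le_of_eq ?_)
          rw [norm_smul, hψ.norm_eq_one, mul_one]
      _ ≤ l2 (B t₁) * l2 χ := integral_norm_mul_norm_le (hBm t₁ ht').1 hχ.memLp
      _ ≤ a * l2 χ := mul_le_mul_of_nonneg_right (hBm t₁ ht').2 (l2_nonneg _)
  have h7 : 0 ≤ Real.exp (-(lam * t₁)) * (E / lam) := by positivity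
  have h8 : Real.exp (-(lam * t₁)) * I t₁ ≤ Real.exp (-(lam * t₁)) * (a * l2 χ) :=
    mul_le_mul_of_nonneg_left h6 (Real.exp_pos _).le
  change I 0 ≤ _
  linarith

/-- The divergence-free field `(σ μ)⁻¹ ∇ × (χ ψ)`, close to the localized Beltrami wave `χ ψ` when
the frequency `μ` is large. -/
lemma exists_datum (hχ : IsCutoff χ) (hψ : IsBeltrami v₀ σ μ ψ) (hσ : σ ^ 2 = 1) (hμ : 0 < μ) :
    ∃ f, IsMagneticDatum f ∧ l2 f ≤ l2 χ + μ⁻¹ * l2 (fderiv ℝ χ) ∧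
      l2 χ ^ 2 - μ⁻¹ * (l2 (fderiv ℝ χ) * l2 χ) ≤ ∫ x, inner ℝ (f x) (χ x • ψ x) := by
  have hG := hχ.contDiff_smul hψ
  have hGc := hχ.hasCompactSupport_smul ψ
  have hσ0 : σ ≠ 0 := by rintro rfl; norm_num at hσ
  have hσ1 : |σ| = 1 := by
    have : |σ| ^ 2 = 1 := by rw [sq_abs, hσ]
    nlinarith [abs_nonneg σ]
  have hf (x : Space) : (σ * μ)⁻¹ • curl (fun y => χ y • ψ y) x =
      χ x • ψ x + (σ * μ)⁻¹ • cross (gradient χ x) (ψ x) := by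
    rw [hψ.curl_packet hχ, smul_add, smul_smul, inv_mul_cancel₀ (mul_ne_zero hσ0 hμ.ne'), one_smul]
  have hR (x : Space) : ‖(σ * μ)⁻¹ • cross (gradient χ x) (ψ x)‖ ≤ μ⁻¹ * ‖fderiv ℝ χ x‖ := by
    rw [norm_smul, norm_inv, norm_mul, Real.norm_eq_abs, hσ1, one_mul, Real.norm_of_nonneg hμ.le]
    exact mul_le_mul_of_nonneg_left (hψ.norm_cross_gradient_le x) (inv_nonneg.2 hμ.le)
  have hdat : IsMagneticDatum (curl (fun y => χ y • ψ y)) :=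
    ⟨contDiff_curl hG, hasCompactSupport_curl hGc, div_curl hG⟩
  refine ⟨_, hdat.const_smul (σ * μ)⁻¹, ?_, ?_⟩
  · have m1 := hχ.memLp.norm
    have m2 : MemLp (fun x => μ⁻¹ • ‖fderiv ℝ χ x‖) 2 volume := hχ.memLp_fderiv.norm.const_mul μ⁻¹
    have n1 : l2 (fun x => ‖χ x‖) ≤ l2 χ := l2_mono hχ.memLp fun x => by simp
    have n2 : l2 (fun x => μ⁻¹ • ‖fderiv ℝ χ x‖) ≤ μ⁻¹ * l2 (fderiv ℝ χ) := by
      rw [l2_const_smul, abs_of_pos (inv_pos.2 hμ)]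
      exact mul_le_mul_of_nonneg_left (l2_mono hχ.memLp_fderiv fun x => by simp)
        (inv_nonneg.2 hμ.le)
    refine (l2_mono (g := fun x => ‖χ x‖ + μ⁻¹ • ‖fderiv ℝ χ x‖) (m1.add m2) fun x => ?_).trans
      ((l2_add_le m1 m2).trans (add_le_add n1 n2))
    rw [hf, Real.norm_of_nonneg (by positivity)]
    refine (norm_add_le _ _).trans (add_le_add (le_of_eq ?_) (hR x))
    rw [norm_smul, hψ.norm_eq_one, mul_one]
  · have i1 : Integrable (fun x => ‖χ x‖ ^ 2) := hχ.memLp.integrable_norm_pow (by simp)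
    have i2 := (integrable_norm_mul_norm hχ.memLp_fderiv hχ.memLp).const_mul μ⁻¹
    calc l2 χ ^ 2 - μ⁻¹ * (l2 (fderiv ℝ χ) * l2 χ)
        ≤ (∫ x, ‖χ x‖ ^ 2) - ∫ x, μ⁻¹ * (‖fderiv ℝ χ x‖ * ‖χ x‖) := by
          rw [integral_norm_sq_eq hχ.memLp, integral_const_mul]
          have := integral_norm_mul_norm_le hχ.memLp_fderiv hχ.memLp
          have := inv_nonneg.2 hμ.le
          gcongr
      _ = ∫ x, (‖χ x‖ ^ 2 - μ⁻¹ * (‖fderiv ℝ χ x‖ * ‖χ x‖)) := (integral_sub i1 i2).symm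
      _ ≤ _ := by
          refine integral_mono (i1.sub i2) (integrable_inner_of_hasCompactSupport
            (hdat.const_smul (σ * μ)⁻¹).smooth.continuous hG.continuous hGc) fun x => ?_
          have hGx : ‖χ x • ψ x‖ = ‖χ x‖ := by rw [norm_smul, hψ.norm_eq_one, mul_one]
          simp only [hf, inner_add_left, real_inner_self_eq_norm_sq, hGx]
          have h1 := (abs_le.1 (abs_real_inner_le_norm
            ((σ * μ)⁻¹ • cross (gradient χ x) (ψ x)) (χ x • ψ x))).1
          rw [hGx] at h1
          have h2 := mul_le_mul_of_nonneg_right (hR x) (norm_nonneg (χ x))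
          linarith

end Packet

/-! ### Failure of uniform bounds -/

lemma exists_cutoff (x₀ : Space) {r : ℝ} (hr : 0 < r) :
    ∃ χ, IsCutoff χ ∧ tsupport χ ⊆ Metric.ball x₀ r ∧ 0 < l2 χ ∧
      ∃ L, ∀ x, ‖fderiv ℝ χ x‖ ≤ L := by
  let χ : ContDiffBump x₀ := ⟨r / 3, r / 2, by positivity, by linarith⟩
  have hχ : IsCutoff χ :=
    ⟨χ.contDiff, χ.hasCompactSupport, fun x => by rw [abs_of_nonneg χ.nonneg]; exact χ.le_one⟩
  refine ⟨χ, hχ, ?_, ?_, ?_⟩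
  · rw [χ.tsupport_eq]
    exact Metric.closedBall_subset_ball (by simp only [χ]; linarith)
  · refine ENNReal.toReal_pos ?_ hχ.memLp.eLpNorm_ne_top
    rw [normL2, Ne, eLpNorm_eq_zero_iff hχ.memLp.1 (by simp)]
    intro h
    have h0 := (Continuous.ae_eq_iff_eq volume χ.continuous continuous_zero).1 h
    have h1 := congrFun h0 x₀
    rw [χ.one_of_mem_closedBall (Metric.mem_closedBall_self χ.rIn_pos.le)] at h1
    exact one_ne_zero h1
  · exact (hχ.compact.fderiv (𝕜 := ℝ)).exists_bound_of_continuous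
      (hχ.smooth.continuous_fderiv (by simp))

lemma SmoothOn.mono {E : Type} [NormedAddCommGroup E] [NormedSpace ℝ E] {T T' : ℝ}
    {u : ℝ → Space → E} (hu : SmoothOn T' u) (h : T ≤ T') : SmoothOn T u :=
  ContDiffOn.mono hu (prod_mono (Ico_subset_Ico_right h) subset_rfl)

lemma SmoothOn.exists_norm_sub_le {E : Type} [NormedAddCommGroup E] [NormedSpace ℝ E] {T : ℝ}
    {u : ℝ → Space → E} (hu : SmoothOn T u) (hT : 0 < T) (x₀ : Space) {η : ℝ} (hη : 0 < η) :
    ∃ ρ > 0, ∀ t ∈ Ico 0 T, t < ρ → ∀ x ∈ Metric.ball x₀ ρ, ‖u t x - u 0 x₀‖ ≤ η := by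
  have hc : ContinuousWithinAt (fun p : ℝ × Space => u p.1 p.2) (Ico 0 T ×ˢ univ) (0, x₀) :=
    (ContDiffOn.continuousOn hu) _ ⟨⟨le_rfl, hT⟩, mem_univ _⟩
  obtain ⟨ρ, hρ, h⟩ := Metric.continuousWithinAt_iff.1 hc η hη
  refine ⟨ρ, hρ, fun t ht htρ x hx => ?_⟩
  have hmem : ((t, x) : ℝ × Space) ∈ Ico 0 T ×ˢ (univ : Set Space) := ⟨ht, mem_univ _⟩
  have := h hmem (by
    rw [Prod.dist_eq, max_lt_iff]
    refine ⟨?_, hx⟩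
    rw [Real.dist_eq, sub_zero, abs_of_nonneg ht.1]
    exact htρ)
  rw [dist_eq_norm] at this
  exact this.le

/-- The choice of the frequency: for large `μ` the bound of `pairing_zero_le` falls below the
initial pairing. The limits of the two sides are `c₀² / 2` and `c₀²`. -/
lemma exists_frequency {c₀ A M t₁ : ℝ} (c₁ K : ℝ) (hc₀ : 0 < c₀) (hA : 0 < A) (hM : 0 < M)
    (ht₁ : 0 < t₁) :
    ∃ μ > 0, M * (c₀ + μ⁻¹ * c₁) * (Real.exp (-(A * μ * t₁)) * c₀ +
      (K * c₁ + 2 * (A / (4 * M)) * μ * c₀) / (A * μ)) < c₀ ^ 2 - μ⁻¹ * (c₁ * c₀) := by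
  have hinv : Filter.Tendsto (fun μ : ℝ => μ⁻¹) Filter.atTop (nhds 0) := tendsto_inv_atTop_zero
  have hexp : Filter.Tendsto (fun μ : ℝ => Real.exp (-(A * μ * t₁))) Filter.atTop (nhds 0) := by
    refine Real.tendsto_exp_neg_atTop_nhds_zero.comp ?_
    exact (Filter.tendsto_id.const_mul_atTop hA).atTop_mul_const ht₁
  have hl := ((hinv.mul_const c₁).const_add c₀).const_mul M
  have hr := (hexp.mul_const c₀).add ((hinv.mul_const (K * c₁ / A)).add_const (c₀ / (2 * M)))
  have h1 := hl.mul hr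
  have h2 := (hinv.mul_const (c₁ * c₀)).const_sub (c₀ ^ 2)
  have hlt : M * (c₀ + 0 * c₁) * (0 * c₀ + (0 * (K * c₁ / A) + c₀ / (2 * M))) <
      c₀ ^ 2 - 0 * (c₁ * c₀) := by
    have : M * (c₀ + 0 * c₁) * (0 * c₀ + (0 * (K * c₁ / A) + c₀ / (2 * M))) = c₀ ^ 2 / 2 := by
      field_simp
      ring
    rw [this]
    nlinarith [pow_pos hc₀ 2]
  obtain ⟨μ, hμ, hμ0⟩ := ((h1.eventually_lt h2 hlt).and (Filter.eventually_gt_atTop 0)).exists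
  refine ⟨μ, hμ0, lt_of_eq_of_lt ?_ hμ⟩
  have : (K * c₁ + 2 * (A / (4 * M)) * μ * c₀) / (A * μ) =
      μ⁻¹ * (K * c₁ / A) + c₀ / (2 * M) := by
    field_simp
    ring
  rw [this]

lemma memLp_of_normL2_le {E : Type} [NormedAddCommGroup E] {u : Space → E} (hu : Continuous u)
    {c : ℝ} (hc : 0 ≤ c) {f : Space → Space} (hf : normL2 f ≠ ⊤)
    (h : normL2 u ≤ ENNReal.ofReal c * normL2 f) : MemLp u 2 volume ∧ l2 u ≤ c * l2 f := by
  have hfin : ENNReal.ofReal c * normL2 f ≠ ⊤ := ENNReal.mul_ne_top ENNReal.ofReal_ne_top hf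
  refine ⟨⟨hu.aestronglyMeasurable, lt_of_le_of_lt h hfin.lt_top⟩, ?_⟩
  have := ENNReal.toReal_mono hfin h
  rwa [ENNReal.toReal_mul, ENNReal.toReal_ofReal hc] at this

/-- There is a magnetic datum none of whose small multiples is the initial value of a solution
that stays bounded by `M` times its initial value, even if the velocity is allowed to deviate from
`v'` by as much. -/
lemma exists_unstable_datum {T : ℝ} (hT : 0 < T) {v' : ℝ → Space → Space} {α : ℝ → Space → ℝ}
    (hv' : SmoothOn T v') (hα : SmoothOn T α) {x₀ : Space} (hα₀ : α 0 x₀ ≠ 0) {M : ℝ}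
    (hM : 0 < M) :
    ∃ f, IsMagneticDatum f ∧ ∃ δ₀ > 0, ∀ δ, 0 < δ → δ ≤ δ₀ → ∀ v B : ℝ → Space → Space,
      SmoothOn T v → SmoothOn T B → InductionEq (Ioo 0 T) v α B →
      (∀ t ∈ Ico 0 T, ∀ x, div (B t) x = 0) → B 0 = (fun x => δ • f x) →
      (∀ t ∈ Ico 0 T, normL2 (B t) ≤ ENNReal.ofReal (M * δ) * normL2 f) →
      (∀ t ∈ Ico 0 T, normL2 (fun x => v t x - v' t x) ≤ ENNReal.ofReal (M * δ) * normL2 f) →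
      False := by
  set α₀ := α 0 x₀ with hα₀def
  set v₀ := v' 0 x₀ with hv₀def
  set σ : ℝ := ((SignType.sign α₀ : SignType) : ℝ) with hσdef
  have hσ : σ ^ 2 = 1 := by
    rcases lt_or_gt_of_ne hα₀ with h | h <;> simp [hσdef, h]
  have hσα : α₀ * σ = |α₀| := by
    rcases lt_or_gt_of_ne hα₀ with h | h <;> simp [hσdef, h, abs_of_neg, abs_of_pos]
  have hA : 0 < |α₀| := abs_pos.2 hα₀
  set η := |α₀| / (4 * M) with hηdef
  have hη : 0 < η := by positivity
  obtain ⟨ρ₁, hρ₁, h₁⟩ := hα.exists_norm_sub_le hT x₀ hη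
  obtain ⟨ρ₂, hρ₂, h₂⟩ := hv'.exists_norm_sub_le hT x₀ hη
  set ρ := min ρ₁ ρ₂ with hρdef
  have hρ : 0 < ρ := lt_min hρ₁ hρ₂
  obtain ⟨χ, hχ, hsupp, hc₀, L, hL⟩ := exists_cutoff x₀ hρ
  have hL0 : 0 ≤ L := (norm_nonneg _).trans (hL 0)
  set t₁ := min (ρ / 2) (T / 2) with ht₁def
  have ht₁ : 0 < t₁ := lt_min (by positivity) (by positivity)
  have ht₁T : t₁ < T := (min_le_right _ _).trans_lt (by linarith)
  have ht₁ρ : t₁ < ρ := (min_le_left _ _).trans_lt (by linarith)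
  obtain ⟨μ, hμ, hlt⟩ := exists_frequency (l2 (fderiv ℝ χ)) (|α₀| + ‖v₀‖ + 2 * η) hc₀ hA hM ht₁
  rw [← hηdef] at hlt
  obtain ⟨ψ, hψ1, hψ2, hψ3, hψ4⟩ := exists_beltrami_wave v₀ hσ μ
  have hψ : IsBeltrami v₀ σ μ ψ := ⟨hψ1, hψ2, hψ3, hψ4⟩
  obtain ⟨f, hf, hfn, hfG⟩ := exists_datum hχ hψ hσ hμ
  have hffin : normL2 f ≠ ⊤ :=
    (hf.smooth.continuous.memLp_of_hasCompactSupport hf.compact).eLpNorm_ne_top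
  set c₀ := l2 χ
  set c₁ := l2 (fderiv ℝ χ)
  have hc₁ : 0 ≤ c₁ := l2_nonneg _
  set nf := c₀ + μ⁻¹ * c₁ with hnf
  have hnf0 : 0 < nf := by positivity
  set X := M * nf * (Real.exp (-(|α₀| * μ * t₁)) * c₀ +
      ((|α₀| + ‖v₀‖ + 2 * η) * c₁ + 2 * η * μ * c₀) / (|α₀| * μ)) with hX
  set Y := c₀ ^ 2 - μ⁻¹ * (c₁ * c₀) with hY
  set D := (μ + L) * (M * nf) ^ 2 / (|α₀| * μ) with hD
  have hD0 : 0 ≤ D := by positivity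
  -- for `δ` up to this value the quadratic error `D δ` stays below the gap `Y - X`
  refine ⟨f, hf, (Y - X) / (D + 1), div_pos (by linarith) (by linarith), ?_⟩
  intro δ hδ hδ₀ v B hv hB heq hdiv hB0 hBn hvn
  have hMδ : 0 ≤ M * δ := by positivity
  have ha : M * δ * l2 f ≤ M * δ * nf := mul_le_mul_of_nonneg_left hfn hMδ
  have hbnd := pairing_zero_le (v' := v') (a := M * δ * nf) ht₁ ht₁T hv hα hB heq hdiv hχ hψ hα₀
    hσ hσα hμ hη.le (by positivity) hL
    (fun t ht x hx => h₂ t ⟨ht.1, ht.2.trans_lt ht₁T⟩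
      ((ht.2.trans_lt ht₁ρ).trans_le (min_le_right _ _)) x
      (Metric.ball_subset_ball (min_le_right _ _) (hsupp hx)))
    (fun t ht x hx => h₁ t ⟨ht.1, ht.2.trans_lt ht₁T⟩
      ((ht.2.trans_lt ht₁ρ).trans_le (min_le_left _ _)) x
      (Metric.ball_subset_ball (min_le_left _ _) (hsupp hx)))
    (fun t ht => by
      have := memLp_of_normL2_le (hB.slice ht).continuous hMδ hffin (hBn t ht)
      exact ⟨this.1, this.2.trans ha⟩)
    (fun t ht => by
      have := memLp_of_normL2_le ((hv.slice ht).continuous.sub (hv'.slice ht).continuous)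
        hMδ hffin (hvn t ht)
      exact ⟨this.1, this.2.trans ha⟩)
  have h0 : ∫ x, inner ℝ (B 0 x) (χ x • ψ x) = δ * ∫ x, inner ℝ (f x) (χ x • ψ x) := by
    rw [hB0, ← integral_const_mul]
    simp only [inner_smul_left, conj_trivial]
  rw [h0] at hbnd
  have h1 : δ * Y ≤ δ * (X + D * δ) := by
    refine (mul_le_mul_of_nonneg_left hfG hδ.le).trans (hbnd.trans (le_of_eq ?_))
    rw [hX, hD]
    ring
  have h2 : Y ≤ X + D * δ := le_of_mul_le_mul_left h1 hδ
  have h3 : δ * (D + 1) ≤ Y - X := (le_div_iff₀ (by linarith)).1 hδ₀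
  linarith

/-! ### Ill-posedness -/

lemma mul_exp_le {T t : ℝ} (C a : ℝ) (ht : t ∈ Ico 0 T) :
    C * Real.exp (a * t) ≤ |C| * Real.exp (|a| * T) := by
  have h1 : a * t ≤ |a| * T :=
    (mul_le_mul_of_nonneg_right (le_abs_self a) ht.1).trans
      (mul_le_mul_of_nonneg_left ht.2.le (abs_nonneg a))
  calc C * Real.exp (a * t) ≤ |C| * Real.exp (a * t) :=
        mul_le_mul_of_nonneg_right (le_abs_self C) (Real.exp_pos _).le
    _ ≤ _ := mul_le_mul_of_nonneg_left (Real.exp_le_exp.2 h1) (abs_nonneg C)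

lemma normL2_const_smul {E : Type} [NormedAddCommGroup E] [NormedSpace ℝ E] {c : ℝ} (hc : 0 ≤ c)
    (f : Space → E) : normL2 (fun x => c • f x) = ENNReal.ofReal c * normL2 f := by
  rw [normL2, show (fun x => c • f x) = c • f from rfl, eLpNorm_const_smul,
    Real.enorm_eq_ofReal hc, normL2]

lemma not_wellPosedL2 {T₀ : ℝ} {v : ℝ → Space → Space} {α : ℝ → Space → ℝ} (hv : SmoothOn T₀ v)
    (hα : SmoothOn T₀ α) {x₀ : Space} (hα₀ : α 0 x₀ ≠ 0) : ¬ WellPosedL2 T₀ v α := by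
  rintro ⟨T, hT, hTT₀, C, a, h⟩
  set M := |C| * Real.exp (|a| * T) + 1 with hM
  have hM0 : 0 < M := by positivity
  obtain ⟨f, hf, δ, hδ, hno⟩ :=
    exists_unstable_datum hT (hv.mono hTT₀) (hα.mono hTT₀) hα₀ hM0
  obtain ⟨⟨B, hB, hBn⟩, -⟩ := h _ (hf.const_smul δ)
  refine hno δ hδ le_rfl v B (hv.mono hTT₀) hB.smooth hB.induction_eq hB.div_free hB.initial
    (fun t ht => (hBn t ht).trans ?_) (fun t ht => ?_)
  · rw [normL2_const_smul hδ.le, ← mul_assoc, ENNReal.ofReal_mul hM0.le]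
    gcongr
    exact (mul_exp_le C a ht).trans (le_add_of_nonneg_right zero_le_one)
  · simp [normL2]

lemma exists_sobolevSmall {f : Space → Space} (hf : ContDiff ℝ ∞ f) (hfc : HasCompactSupport f)
    (N : ℕ) {η : ℝ} (hη : 0 < η) :
    ∃ δ₀ : ℝ, 0 < δ₀ ∧ ∀ δ : ℝ, 0 < δ → δ ≤ δ₀ → SobolevSmall N η (fun x => δ • f x) := by
  have hm (j : ℕ) : MemLp (iteratedFDeriv ℝ j f) 2 volume :=
    (hf.continuous_iteratedFDeriv (by exact_mod_cast le_top)).memLp_of_hasCompactSupport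
      (hfc.iteratedFDeriv (𝕜 := ℝ) j)
  set S := ∑ j ∈ Finset.range (N + 1), l2 (iteratedFDeriv ℝ j f) with hS
  have hS0 : 0 ≤ S := Finset.sum_nonneg fun j _ => l2_nonneg _
  refine ⟨η / (S + 1), by positivity, fun δ hδ hδ₀ j hj => ?_⟩
  have h1 : iteratedFDeriv ℝ j (fun x => δ • f x) = fun x => δ • iteratedFDeriv ℝ j f x := by
    funext x
    exact iteratedFDeriv_const_smul_apply (𝕜 := ℝ) (a := δ)
      (hf.contDiffAt.of_le (by exact_mod_cast le_top))
  have h2 : l2 (iteratedFDeriv ℝ j f) ≤ S :=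
    Finset.single_le_sum (f := fun j => l2 (iteratedFDeriv ℝ j f)) (fun i _ => l2_nonneg _)
      (Finset.mem_range.2 (by omega))
  rw [h1, normL2_const_smul hδ.le, ← ENNReal.ofReal_toReal (a := normL2 _) (hm j).eLpNorm_ne_top,
    ← ENNReal.ofReal_mul hδ.le]
  refine ENNReal.ofReal_le_ofReal ?_
  have h3 : δ * (S + 1) ≤ η := (le_div_iff₀ (by linarith)).1 hδ₀
  have h4 : δ * l2 (iteratedFDeriv ℝ j f) ≤ δ * (S + 1) := by gcongr; linarith
  exact h4.trans h3

lemma not_coupledWellPosedL2 {m : ℕ} {T₀ : ℝ} (hT₀ : 0 < T₀) {α : ℝ → Space → ℝ}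
    (hα : SmoothOn T₀ α) {x₀ : Space} (hα₀ : α 0 x₀ ≠ 0) (𝓕 : FluidTheory m)
    {w₀ : ℝ → Space → EuclideanSpace ℝ (Fin m)}
    (hw₀ : IsCoupledSolution T₀ α 𝓕 w₀ (fun _ _ => 0)) :
    ¬ CoupledWellPosedL2 T₀ α 𝓕 w₀ (fun _ _ => 0) := by
  rintro ⟨T, hT, hTT₀, C, a, N, η, hη, h⟩
  let ℓ : EuclideanSpace ℝ (Fin m) →L[ℝ] Space := LinearMap.toContinuousLinearMap 𝓕.vel
  have hℓ (y : EuclideanSpace ℝ (Fin m)) : 𝓕.vel y = ℓ y := rfl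
  have hvel {u : ℝ → Space → EuclideanSpace ℝ (Fin m)} (hu : SmoothOn T u) :
      SmoothOn T (fun t x => 𝓕.vel (u t x)) := ℓ.contDiff.comp_contDiffOn hu
  set K := |C| * Real.exp (|a| * T) with hK
  have hK0 : 0 ≤ K := by positivity
  -- `M` serves both the magnetic field and the velocity, whose deviation gains a factor `‖ℓ‖`
  set M := K * (1 + ‖ℓ‖) + 1 with hM
  have hM0 : 0 < M := by positivity
  have hKM : K ≤ M := by nlinarith [mul_nonneg hK0 (norm_nonneg ℓ)]
  have hKM' : ‖ℓ‖ * K ≤ M := by nlinarith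
  obtain ⟨f, hf, δ₁, hδ₁, hno⟩ := exists_unstable_datum hT
    (hvel (hw₀.smooth_fluid.mono hTT₀)) (hα.mono hTT₀) hα₀ hM0
  obtain ⟨δ₂, hδ₂, hsmall⟩ := exists_sobolevSmall hf.smooth hf.compact N hη
  set δ := min δ₁ δ₂
  have hδ : 0 < δ := lt_min hδ₁ hδ₂
  have hzero : SobolevSmall N η (fun _ : Space => (0 : EuclideanSpace ℝ (Fin m))) := by
    intro j _
    have : iteratedFDeriv ℝ j (fun _ : Space => (0 : EuclideanSpace ℝ (Fin m))) = 0 :=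
      iteratedFDeriv_fun_zero
    simp [this, normL2]
  obtain ⟨⟨w, B, hsol, -, hB0, hbnd⟩, -⟩ := h (fun _ => 0) (fun x => δ • f x) contDiff_const
    HasCompactSupport.zero (by simpa using hw₀.constraint 0 ⟨le_rfl, hT₀⟩) (hf.const_smul δ) hzero
    (hsmall δ hδ (min_le_right _ _))
  have hK' : ∀ t ∈ Ico 0 T, coupledDist (w t) (w₀ t) (B t) (fun _ => 0) ≤
      ENNReal.ofReal K * (ENNReal.ofReal δ * normL2 f) := by
    intro t ht
    refine (hbnd t ht).trans ?_
    have h0 : normL2 (fun _ : Space => (0 : EuclideanSpace ℝ (Fin m))) = 0 := by simp [normL2]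
    rw [h0, zero_add, normL2_const_smul hδ.le]
    gcongr
    exact mul_exp_le C a ht
  refine hno δ hδ (min_le_left _ _) _ B (hvel hsol.smooth_fluid) hsol.smooth_magnetic
    hsol.induction_eq hsol.div_free (by simpa using! hB0) (fun t ht => ?_) (fun t ht => ?_)
  · have h1 : normL2 (B t) ≤ coupledDist (w t) (w₀ t) (B t) (fun _ => 0) := by
      simp [coupledDist]
    refine h1.trans ((hK' t ht).trans ?_)
    rw [ENNReal.ofReal_mul hM0.le, mul_assoc]
    gcongr
  · have h1 : normL2 (fun x => w t x - w₀ t x) ≤ coupledDist (w t) (w₀ t) (B t) (fun _ => 0) :=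
      le_self_add
    have h2 : normL2 (fun x => 𝓕.vel (w t x) - 𝓕.vel (w₀ t x)) ≤
        ENNReal.ofReal ‖ℓ‖ * normL2 (fun x => w t x - w₀ t x) := by
      refine eLpNorm_le_mul_eLpNorm_of_ae_le_mul (Filter.Eventually.of_forall fun x => ?_) 2
      rw [hℓ, hℓ, ← map_sub]
      exact ℓ.le_opNorm _
    refine h2.trans ?_
    calc ENNReal.ofReal ‖ℓ‖ * normL2 (fun x => w t x - w₀ t x)
        ≤ ENNReal.ofReal ‖ℓ‖ * (ENNReal.ofReal K * (ENNReal.ofReal δ * normL2 f)) := by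
          gcongr
          exact h1.trans (hK' t ht)
      _ = ENNReal.ofReal (‖ℓ‖ * K) * ENNReal.ofReal δ * normL2 f := by
          rw [ENNReal.ofReal_mul (norm_nonneg _)]; ring
      _ ≤ ENNReal.ofReal (M * δ) * normL2 f := by
          rw [ENNReal.ofReal_mul hM0.le]
          gcongr

end MeanFieldDynamo

end

theorem mainTheorem1 (T₀ : ℝ) (hT₀ : 0 < T₀)
    (v : ℝ → MeanFieldDynamo.Space → MeanFieldDynamo.Space)
    (α : ℝ → MeanFieldDynamo.Space → ℝ)
    (hv : MeanFieldDynamo.SmoothOn T₀ v) (hα : MeanFieldDynamo.SmoothOn T₀ α) :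
    -- the system is not strongly hyperbolic
    (∀ t ∈ Set.Ico 0 T₀,
      MeanFieldDynamo.HasPrincipalPart (MeanFieldDynamo.dynamoOp (v t) (α t))
        (fun x => MeanFieldDynamo.dynamoMatrix (v t x) (α t x)) ∧
      ∀ x, α t x ≠ 0 →
        ¬ MeanFieldDynamo.StronglyHyperbolic
          (MeanFieldDynamo.dynamoMatrix (v t x) (α t x))) ∧
    -- the system with coefficients frozen at a point where `α ≠ 0`
    (∀ t₀ ∈ Set.Ico 0 T₀, ∀ x₀, α t₀ x₀ ≠ 0 →
      -- dispersion relation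
      (∀ (k : MeanFieldDynamo.Space) (ν : ℂ),
        (∃ b : MeanFieldDynamo.Vec ℂ, b ≠ 0 ∧
          MeanFieldDynamo.InductionEq Set.univ (fun _ _ => v t₀ x₀) (fun _ _ => α t₀ x₀)
            (MeanFieldDynamo.planeWave ν k b)) ↔
        ν * ((((inner ℝ k (v t₀ x₀) : ℝ) : ℂ) + ν) ^ 2
          + ((‖k‖ : ℝ) : ℂ) ^ 2 * ((α t₀ x₀ : ℝ) : ℂ) ^ 2) = 0) ∧
      -- growing divergence-free mode for every nonzero wave vector
      (∀ k : MeanFieldDynamo.Space, k ≠ 0 →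
        ∃ b : MeanFieldDynamo.Vec ℂ, b ≠ 0 ∧
          ∃ B : ℝ → MeanFieldDynamo.Space → MeanFieldDynamo.Vec ℂ,
            B = MeanFieldDynamo.planeWave
              (-((inner ℝ k (v t₀ x₀) : ℝ) : ℂ)
                - Complex.I * ((‖k‖ * |α t₀ x₀| : ℝ) : ℂ)) k b ∧
            MeanFieldDynamo.InductionEq Set.univ (fun _ _ => v t₀ x₀) (fun _ _ => α t₀ x₀) B ∧
            (∀ t x, MeanFieldDynamo.div (B t) x = 0) ∧
            (∀ t x, ‖B t x‖ = Real.exp (|α t₀ x₀| * ‖k‖ * t) * ‖B 0 x‖)) ∧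
      (∀ t : ℝ, 0 < t →
        Filter.Tendsto (fun k : ℝ => Real.exp (|α t₀ x₀| * k * t)) Filter.atTop Filter.atTop) ∧
      -- no `L²` estimate, even for solutions of finite energy
      (∀ T t C : ℝ, 0 < t → t < T →
        ∃ f B, MeanFieldDynamo.IsSolution T (fun _ _ => v t₀ x₀) (fun _ _ => α t₀ x₀) f B ∧
          ENNReal.ofReal C * MeanFieldDynamo.normL2 f < MeanFieldDynamo.normL2 (B t)) ∧
      -- ill-posedness of the frozen system
      (∀ T : ℝ, ¬ MeanFieldDynamo.WellPosedL2 T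
        (fun _ _ => v t₀ x₀) (fun _ _ => α t₀ x₀))) ∧
    -- ill-posedness with variable coefficients, and of any coupling with fluid equations near a
    -- background flow without magnetic field
    ((∃ x, α 0 x ≠ 0) →
      ¬ MeanFieldDynamo.WellPosedL2 T₀ v α ∧
      ∀ (m : ℕ) (𝓕 : MeanFieldDynamo.FluidTheory m)
        (w : ℝ → MeanFieldDynamo.Space → EuclideanSpace ℝ (Fin m)),
        MeanFieldDynamo.IsCoupledSolution T₀ α 𝓕 w (fun _ _ => 0) →
        ¬ MeanFieldDynamo.CoupledWellPosedL2 T₀ α 𝓕 w (fun _ _ => 0)) := by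
  refine ⟨fun t ht => ⟨MeanFieldDynamo.hasPrincipalPart_dynamoOp
      ((hv.slice ht).differentiable (by simp)) ((hα.slice ht).differentiable (by simp)),
      fun x hx => MeanFieldDynamo.not_stronglyHyperbolic _ hx⟩,
    fun t₀ _ x₀ hα₀ => ⟨fun k ν => MeanFieldDynamo.exists_planeWave_iff _ _ k ν,
      fun k hk => MeanFieldDynamo.exists_growing_planeWave _ hα₀ hk, fun t ht => ?_,
      fun T t C ht htT => MeanFieldDynamo.exists_amplified_solution _ hα₀ C ht htT,
      fun T => MeanFieldDynamo.not_wellPosedL2 contDiffOn_const contDiffOn_const (x₀ := x₀) hα₀⟩,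
    fun ⟨x₀, hα₀⟩ => ⟨MeanFieldDynamo.not_wellPosedL2 hv hα hα₀,
      fun m 𝓕 w hw => MeanFieldDynamo.not_coupledWellPosedL2 hT₀ hα hα₀ 𝓕 hw⟩⟩
  exact Real.tendsto_exp_atTop.comp
    ((Filter.tendsto_id.const_mul_atTop (abs_pos.2 hα₀)).atTop_mul_const ht)
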